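/- Let $N\ge 0$ and let $\omega^{ij}(x)$ be a smooth Poisson bivector on $\mathbb R^N$, i.e. $\omega^{ij}=-\omega^{ji}$ and $\omega^{il}\partial_l\omega^{jk}+\omega^{kl}\partial_l\omega^{ij}+\omega^{jl}\partial_l\omega^{ki}=0$. Let $\xi^\mu=(x^i,p_i)$, $\mu=1,\dots,2N$, be coordinates on $\mathbb R^{2N}$, $\partial_\mu=\partial/\partial\xi^\mu$, $\partial_i=\partial/\partial x^i$, $\partial^p_i=\partial_{N+i}=\partial/\partial p_i$, and $\Omega^0=\begin{pmatrix}0&1\\-1&0\end{pmatrix}$. All series are formal power series in $\theta$ with coefficients in $C^\infty(\mathbb R^{2N})$; repeated indices are summed. A *formal symplectic realization* of $\omega$ is an antisymmetric matrix $\Omega=\Omega^0+\sum_{n\ge1}\theta^n\Omega^n(x,p)$ with $\Omega_{ij}=\theta\omega^{ij}(x)$ for $1\le i,j\le N$ which satisfies the Jacobi identity $\Omega_{\mu\sigma}\partial_\sigma\Omega_{\nu\alpha}+\Omega_{\alpha\sigma}\partial_\sigma\Omega_{\mu\nu}+\Omega_{\nu\sigma}\partial_\sigma\Omega_{\alpha\mu}=0$.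 Consider the equation $$\bar\Omega_{\mu\nu}:=\partial_\mu J_\nu-\partial_\nu J_\mu=(\Omega^{-1})_{\mu\nu}\qquad(\ast)$$ for a series $J_\mu=\sum_{n\ge 0}\theta^nJ_\mu^n(x,p)$ (the symplectic potential) and a matrix $\Omega=\Omega^0+\sum_{n\ge1}\theta^n\Omega^n$ with $\Omega_{ij}=\theta\omega^{ij}(x)$. For $n\ge1$ put $$S^n=\sum_{k\ge2}\ \sum_{\substack{m_1,\dots,m_k\ge1\\ m_1+\dots+m_k=n}}\Omega^{m_1}\Omega^0\Omega^{m_2}\Omega^0\cdots\Omega^0\Omega^{m_k},\qquad G^1_{ij}=\omega^{ij}(x),\qquad G^n_{ij}=S^n_{ij}\quad (n\ge2),$$ and $G^0_{ij}=0$. Then: 1. A formal symplectic realization $\Omega$ of $\omega$ exists which is obtained from a symplectic potential $J$ through $(\ast)$. 2. For every solution $(J,\Omega)$ of $(\ast)$, $\Omega$ is a formal symplectic realization of $\omega$. 3. Let $n\ge1$ and let $J,\Omega$ satisfy $(\ast)$, with $\Omega_{ij}=\theta\omega^{ij}$, in all orders $\theta^m$ with $m<n$, where $\Omega$ has leading term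 $\Omega^0$. Then they satisfy these conditions in order $\theta^n$ as well if and only if $$\partial^p_iJ^n_{N+j}-\partial^p_jJ^n_{N+i}=G^n_{ij}\quad(1\le i,j\le N)\qquad\text{and}\qquad \Omega^n=-\Omega^0\bar\Omega^n\Omega^0-S^n,$$ and the integrability condition of the first equation holds: $$\partial^p_kG^n_{ij}+\partial^p_iG^n_{jk}+\partial^p_jG^n_{ki}=0\quad\text{for all } i,j,k.$$ 4. The freedom in the construction is one arbitrary vector $J_i(x,p,\theta)$, $1\le i\le N$, and one arbitrary function $f(x,p,\theta)=\sum_{n\ge 0}\theta^nf^n(x,p)$, subject only to the condition $J^0_i=p_i+\partial_if^0$ on the leading terms, which $\Omega^0$ imposes. Precisely, for every such $J_i$ and $f$ there is exactly one solution $(J,\Omega)$ of $(\ast)$ with these components $J_i$ and with $$J_{N+i}^n(x,p)=\int_0^1 s\,p_j\,G^n_{ji}(x,sp)\,ds+\partial^p_if^n(x,p)\qquad(n\ge0),$$ and every solution of $(\ast)$ is obtained in this way from some $J_i$ and $f$. -/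

import Mathlib

/-- Index set of the phase-space coordinates: `Sum.inl i` is the index `i` (the coordinate `x^i`),
`Sum.inr i` is the index `N + i` (the coordinate `p_i`). -/
abbrev PhaseIdx (N : ℕ) : Type := Fin N ⊕ Fin N

/-- The phase space `ℝ^{2N}` of points `ξ = (x, p)`. -/
abbrev Phase (N : ℕ) : Type := PhaseIdx N → ℝ

/-- Real functions on phase space, a commutative ring under pointwise operations. -/
abbrev PhaseFn (N : ℕ) : Type := Phase N → ℝ

/-- Formal power series in `θ` (the variable `PowerSeries.X`) whose coefficients are functions on
phase space. -/
abbrev PhaseSeries (N : ℕ) : Type := PowerSeries (PhaseFn N)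

noncomputable section

/-- The partial derivative `∂_σ F = ∂F/∂ξ^σ`. -/
def pd {N : ℕ} (σ : PhaseIdx N) (F : PhaseFn N) : PhaseFn N :=
  fun ξ => fderiv ℝ F ξ (Pi.single σ 1)

/-- The partial derivative `∂_σ` of a formal power series, taken coefficient by coefficient. -/
def sd {N : ℕ} (σ : PhaseIdx N) (F : PhaseSeries N) : PhaseSeries N :=
  PowerSeries.mk fun n => pd σ (PowerSeries.coeff n F)

/-- All coefficients of the formal power series are `C^∞` functions. -/
def SmoothSeries {N : ℕ} (F : PhaseSeries N) : Prop :=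
  ∀ n, ContDiff ℝ ((⊤ : ℕ∞) : WithTop ℕ∞) (PowerSeries.coeff n F)

/-- A smooth Poisson bivector `ω^{ij}(x)` on `ℝ^N`: antisymmetric, with the Jacobi identity
`ω^{il}∂_l ω^{jk} + ω^{kl}∂_l ω^{ij} + ω^{jl}∂_l ω^{ki} = 0`. -/
structure IsPoissonBivector {N : ℕ} (ω : Fin N → Fin N → (Fin N → ℝ) → ℝ) : Prop where
  smooth : ∀ i j, ContDiff ℝ ((⊤ : ℕ∞) : WithTop ℕ∞) (ω i j)
  antisymm : ∀ i j x, ω i j x = -ω j i x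
  jacobi : ∀ i j k x,
    ∑ l, (ω i l x * fderiv ℝ (ω j k) x (Pi.single l 1)
      + ω k l x * fderiv ℝ (ω i j) x (Pi.single l 1)
      + ω j l x * fderiv ℝ (ω k i) x (Pi.single l 1)) = 0

/-- The series `θ ω^{ij}(x)`, as a series of functions of `(x, p)`. -/
def thetaOmega {N : ℕ} (ω : Fin N → Fin N → (Fin N → ℝ) → ℝ) (i j : Fin N) : PhaseSeries N :=
  PowerSeries.X * PowerSeries.C (fun ξ : Phase N => ω i j fun l => ξ (Sum.inl l))

/-- The canonical symplectic matrix `Ω⁰ = ((0, 1), (-1, 0))`. -/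
def canonMatrix (N : ℕ) : Matrix (PhaseIdx N) (PhaseIdx N) (PhaseFn N) :=
  Matrix.fromBlocks 0 1 (-1) 0

/-- The coefficient of `θ^n` of a matrix of formal power series. -/
def matCoeff {N : ℕ} (n : ℕ) (M : Matrix (PhaseIdx N) (PhaseIdx N) (PhaseSeries N)) :
    Matrix (PhaseIdx N) (PhaseIdx N) (PhaseFn N) :=
  M.map (PowerSeries.coeff n)

/-- The Jacobi identity
`Ω_{μσ}∂_σ Ω_{να} + Ω_{ασ}∂_σ Ω_{μν} + Ω_{νσ}∂_σ Ω_{αμ} = 0` of formal power series. -/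
def SatisfiesJacobi {N : ℕ} (Om : Matrix (PhaseIdx N) (PhaseIdx N) (PhaseSeries N)) : Prop :=
  ∀ μ ν α, ∑ σ, (Om μ σ * sd σ (Om ν α) + Om α σ * sd σ (Om μ ν) + Om ν σ * sd σ (Om α μ)) = 0

/-- A formal symplectic realization of `ω`: a Poisson bivector `Ω = Ω⁰ + ∑ θ^n Ω^n` on `ℝ^{2N}`
with canonical leading term and `Ω_{ij} = θ ω^{ij}(x)`. -/
structure IsFormalRealization {N : ℕ} (ω : Fin N → Fin N → (Fin N → ℝ) → ℝ)
    (Om : Matrix (PhaseIdx N) (PhaseIdx N) (PhaseSeries N)) : Prop where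
  smooth : ∀ μ ν, SmoothSeries (Om μ ν)
  antisymm : ∀ μ ν, Om μ ν = -Om ν μ
  leading : matCoeff 0 Om = canonMatrix N
  base : ∀ i j, Om (Sum.inl i) (Sum.inl j) = thetaOmega ω i j
  jacobi : SatisfiesJacobi Om

/-- The matrix `∂_μ J_ν - ∂_ν J_μ` of a vector of formal power series. -/
def curl {N : ℕ} (J : PhaseIdx N → PhaseSeries N) :
    Matrix (PhaseIdx N) (PhaseIdx N) (PhaseSeries N) :=
  Matrix.of fun μ ν => sd μ (J ν) - sd ν (J μ)

/-- `J` is a symplectic potential for `Ω`, where `Ω = Ω⁰ + ∑ θ^n Ω^n` and `Ω_{ij} = θ ω^{ij}(x)`: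
the equation `∂_μ J_ν - ∂_ν J_μ = (Ω⁻¹)_{μν}` holds. -/
structure IsPotentialSolution {N : ℕ} (ω : Fin N → Fin N → (Fin N → ℝ) → ℝ)
    (J : PhaseIdx N → PhaseSeries N)
    (Om : Matrix (PhaseIdx N) (PhaseIdx N) (PhaseSeries N)) : Prop where
  smooth_potential : ∀ μ, SmoothSeries (J μ)
  smooth : ∀ μ ν, SmoothSeries (Om μ ν)
  leading : matCoeff 0 Om = canonMatrix N
  base : ∀ i j, Om (Sum.inl i) (Sum.inl j) = thetaOmega ω i j
  inverse : curl J * Om = 1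

/-- The same equation, required only in the orders `θ^m` with `m < n`. Nothing but smoothness is
asked of the coefficients of `J` and `Ω` of order `n` and higher (for `n ≥ 1`). -/
structure IsPotentialSolutionBelow {N : ℕ} (ω : Fin N → Fin N → (Fin N → ℝ) → ℝ) (n : ℕ)
    (J : PhaseIdx N → PhaseSeries N)
    (Om : Matrix (PhaseIdx N) (PhaseIdx N) (PhaseSeries N)) : Prop where
  smooth_potential : ∀ μ, SmoothSeries (J μ)
  smooth : ∀ μ ν, SmoothSeries (Om μ ν)
  leading : matCoeff 0 Om = canonMatrix N
  base : ∀ m < n, ∀ i j, PowerSeries.coeff m (Om (Sum.inl i) (Sum.inl j)) =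
    PowerSeries.coeff m (thetaOmega ω i j)
  inverse : ∀ m < n, matCoeff m (curl J * Om) = matCoeff m 1

/-- The sum of `Ω^{m₁} Ω⁰ Ω^{m₂} Ω⁰ ⋯ Ω⁰ Ω^{m_k}` over all `k ≥ 2` and all `m₁, …, m_k ≥ 1` with
`m₁ + ⋯ + m_k = n`. It involves only the coefficients `Ω^m` with `1 ≤ m < n`. -/
def chainSum {N : ℕ} (Om : Matrix (PhaseIdx N) (PhaseIdx N) (PhaseSeries N)) (n : ℕ) :
    Matrix (PhaseIdx N) (PhaseIdx N) (PhaseFn N) :=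
  ∑ c : Composition n with 2 ≤ c.length,
    ((c.blocks.map fun m => matCoeff m Om).intersperse (canonMatrix N)).prod

/-- The right-hand side of the equation `∂^p_i J_{N+j}^n - ∂^p_j J_{N+i}^n = G^n_{ij}` that
determines `J_{N+i}^n`: it is `ω^{ij}(x)` for `n = 1`, and the `(i, j)` entry of `chainSum`
for `n ≥ 2`. -/
def momentumRHS {N : ℕ} (ω : Fin N → Fin N → (Fin N → ℝ) → ℝ)
    (Om : Matrix (PhaseIdx N) (PhaseIdx N) (PhaseSeries N)) (n : ℕ) (i j : Fin N) : PhaseFn N :=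
  PowerSeries.coeff n (thetaOmega ω i j) + chainSum Om n (Sum.inl i) (Sum.inl j)

/-- The particular solution `u_i(x, p) = ∫₀¹ s p_j G_{ji}(x, s p) ds` of
`∂^p_i u_j - ∂^p_j u_i = G_{ij}`. -/
def radialSolution {N : ℕ} (G : Fin N → Fin N → PhaseFn N) (i : Fin N) : PhaseFn N :=
  fun ξ => ∫ s in (0 : ℝ)..1, ∑ j, s * ξ (Sum.inr j) *
    G j i (Sum.elim (fun l => ξ (Sum.inl l)) (fun l => s * ξ (Sum.inr l)))

/-- The data `J_i(x, p, θ)`, `f(x, p, θ)` of the construction: arbitrary smooth formal power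
series, apart from the leading term `J_i^0 = p_i + ∂_i f^0`, which `Ω⁰` dictates. -/
structure IsConstructionData {N : ℕ} (I : Fin N → PhaseSeries N) (f : PhaseSeries N) : Prop where
  smooth_vec : ∀ i, SmoothSeries (I i)
  smooth_fun : SmoothSeries f
  leading : ∀ i, PowerSeries.coeff 0 (I i) =
    (fun ξ : Phase N => ξ (Sum.inr i)) + pd (Sum.inl i) (PowerSeries.coeff 0 f)

/-- `J` is built from the data `(I, f)`: `J_i = I_i`, and in each order `n`, `J_{N+i}^n` is the
particular solution with right-hand side `G^n` plus `∂^p_i f^n`. -/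
def BuiltFrom {N : ℕ} (ω : Fin N → Fin N → (Fin N → ℝ) → ℝ)
    (I : Fin N → PhaseSeries N) (f : PhaseSeries N) (J : PhaseIdx N → PhaseSeries N)
    (Om : Matrix (PhaseIdx N) (PhaseIdx N) (PhaseSeries N)) : Prop :=
  (∀ i, J (Sum.inl i) = I i) ∧
  ∀ n i, PowerSeries.coeff n (J (Sum.inr i)) =
    radialSolution (momentumRHS ω Om n) i + pd (Sum.inr i) (PowerSeries.coeff n f)

end

/-! Let Ω̄ denote the closed two-form ∂_μ J_ν − ∂_ν J_μ. Its inverse satisfies Jacobi for the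
classical reason: ∂Ω = −Ω(∂Ω̄)Ω turns the Jacobi sum into dΩ̄ contracted with three copies of Ω
(`satisfiesJacobi_of_curl_mul_eq_one`). The real work is to meet the condition Ω_{ij} = θω^{ij}.

Since (Ω⁰)² = −1, the inverse of Ω is −Ω⁰ times the geometric series in (Ω − Ω⁰)Ω⁰, whose order n is
a sum over compositions of n. The one-block composition contributes Ω^n; the others make up S^n and
see only lower orders. Hence order n of Ω̄Ω = 1 reads Ω^n = −Ω⁰Ω̄^nΩ⁰ − S^n
(`matCoeff_mul_eq_one_iff`). Conjugation by Ω⁰ moves the momentum block of Ω̄ to the block ij, so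
the condition on Ω_{ij} becomes a curl equation in p with right-hand side G^n.

The crux is that G^n is closed in p. Drop the orders ≥ n of J. What is left still defines an exactly
closed form, whose inverse Ω' agrees with Ω below order n and has Ω'^n = −S^n
(`IsPotentialSolutionBelow.exists_truncation`). In order n of its Jacobi identity with indices ijk,
only the p-derivatives of S^n survive and, for n = 2, the Jacobi expression of ω, which is zero
(`IsPotentialSolutionBelow.chainSum_closed`).

The curl equation is then solved by a homotopy integral (`curl_radialSolution`), uniquely up to a
p-gradient by the Poincaré lemma with x as parameter (`exists_pd_eq_of_closed`). So Ω^n is a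
function of the data and of the lower orders, and the solutions built from given data correspond to
the fixed points of `constructionStep`, of which there is exactly one. Order zero is special because
Ω⁰ is prescribed: there J⁰ − (p, 0) is closed in all 2N coordinates, which yields f⁰. -/

noncomputable section

/-- The smooth functions on phase space, as a subring of all functions. -/
def smoothSubring (N : ℕ) : Subring (PhaseFn N) where
  carrier := {F | ContDiff ℝ ((⊤ : ℕ∞) : WithTop ℕ∞) F}
  mul_mem' := fun {F G} hF hG => by
    rw [Set.mem_ofPred] at *
    exact ContDiff.mul hF hG
  one_mem' := by
    rw [Set.mem_ofPred]
    exact contDiff_const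
  add_mem' := fun {F G} hF hG => by
    rw [Set.mem_ofPred] at *
    exact ContDiff.add hF hG
  zero_mem' := by
    rw [Set.mem_ofPred]
    exact contDiff_const
  neg_mem' := fun {F} hF => by
    rw [Set.mem_ofPred] at *
    exact ContDiff.neg hF

/-! ### Calculus of partial derivatives of smooth functions. -/

section PartialDerivatives

variable {N : ℕ}

theorem mem_smoothSubring {F : PhaseFn N} :
    F ∈ smoothSubring N ↔ ContDiff ℝ ((⊤ : ℕ∞) : WithTop ℕ∞) F := Iff.rfl

theorem differentiable_of_mem {F : PhaseFn N} (hF : F ∈ smoothSubring N) : Differentiable ℝ F :=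
  ContDiff.differentiable (mem_smoothSubring.1 hF) (by simp)

theorem pd_mem (σ : PhaseIdx N) {F : PhaseFn N} (hF : F ∈ smoothSubring N) :
    pd σ F ∈ smoothSubring N :=
  mem_smoothSubring.2 (((mem_smoothSubring.1 hF).fderiv_right (m := ((⊤ : ℕ∞) : WithTop ℕ∞))
    (by simp)).clm_apply contDiff_const)

theorem pd_add (σ : PhaseIdx N) {F G : PhaseFn N} (hF : F ∈ smoothSubring N)
    (hG : G ∈ smoothSubring N) : pd σ (F + G) = pd σ F + pd σ G := by
  funext ξ
  simp [pd, fderiv_add (differentiable_of_mem hF ξ) (differentiable_of_mem hG ξ)]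

theorem pd_neg (σ : PhaseIdx N) (F : PhaseFn N) : pd σ (-F) = -pd σ F := by
  funext ξ
  simp [pd, fderiv_neg]

theorem pd_sub (σ : PhaseIdx N) {F G : PhaseFn N} (hF : F ∈ smoothSubring N)
    (hG : G ∈ smoothSubring N) : pd σ (F - G) = pd σ F - pd σ G := by
  rw [sub_eq_add_neg, pd_add σ hF (neg_mem hG), pd_neg, sub_eq_add_neg]

theorem pd_mul (σ : PhaseIdx N) {F G : PhaseFn N} (hF : F ∈ smoothSubring N)
    (hG : G ∈ smoothSubring N) : pd σ (F * G) = F * pd σ G + pd σ F * G := by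
  funext ξ
  simp [pd, fderiv_mul (differentiable_of_mem hF ξ) (differentiable_of_mem hG ξ)]
  ring

theorem pd_const (σ : PhaseIdx N) (a : ℝ) : pd σ (fun _ => a) = 0 := by
  funext ξ
  simp [pd]

theorem pd_zero (σ : PhaseIdx N) : pd σ (0 : PhaseFn N) = 0 := pd_const σ 0

theorem pd_one (σ : PhaseIdx N) : pd σ (1 : PhaseFn N) = 0 := pd_const σ 1

theorem pd_sum (σ : PhaseIdx N) {ι : Type*} (s : Finset ι) {F : ι → PhaseFn N}
    (hF : ∀ i ∈ s, F i ∈ smoothSubring N) : pd σ (∑ i ∈ s, F i) = ∑ i ∈ s, pd σ (F i) := by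
  classical
  induction s using Finset.induction_on with
  | empty => simp [pd_zero]
  | insert a s ha ih =>
    have hs : ∀ i ∈ s, F i ∈ smoothSubring N := fun i hi => hF i (Finset.mem_insert_of_mem hi)
    rw [Finset.sum_insert ha, Finset.sum_insert ha, ← ih hs,
      pd_add σ (hF a (Finset.mem_insert_self a s)) (sum_mem hs)]

/-- Both sides are values of the second Fréchet derivative, which is symmetric. -/
theorem pd_comm (σ τ : PhaseIdx N) {F : PhaseFn N} (hF : F ∈ smoothSubring N) :
    pd σ (pd τ F) = pd τ (pd σ F) := by
  have key : ∀ (a b : PhaseIdx N) (ξ : Phase N),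
      pd a (pd b F) ξ = fderiv ℝ (fderiv ℝ F) ξ (Pi.single a 1) (Pi.single b 1) := by
    intro a b ξ
    have hd : DifferentiableAt ℝ (fderiv ℝ F) ξ :=
      (((mem_smoothSubring.1 hF).fderiv_right (m := ((⊤ : ℕ∞) : WithTop ℕ∞))
        (by simp)).differentiable (by simp)) ξ
    change fderiv ℝ (fun η => fderiv ℝ F η (Pi.single b 1)) ξ (Pi.single a 1) = _
    rw [fderiv_clm_apply hd (differentiableAt_const _)]
    simp
  funext ξ
  rw [key, key]
  exact ((mem_smoothSubring.1 hF).contDiffAt.isSymmSndFDerivAt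
    (by rw [minSmoothness_of_isRCLikeNormedField]; exact WithTop.coe_le_coe.2 le_top)) _ _

theorem fderiv_eq_sum_pd (F : PhaseFn N) (ξ v : Phase N) :
    fderiv ℝ F ξ v = ∑ μ, v μ * pd μ F ξ := by
  conv_lhs => rw [← Finset.univ_sum_single v]
  rw [map_sum]
  refine Finset.sum_congr rfl fun μ _ => ?_
  rw [pd, ← smul_eq_mul, ← map_smul, ← Pi.single_smul, smul_eq_mul, mul_one]

theorem coord_mem (μ : PhaseIdx N) : (fun ξ : Phase N => ξ μ) ∈ smoothSubring N :=
  mem_smoothSubring.2 (contDiff_apply ℝ ℝ μ)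

theorem pd_coord (σ μ : PhaseIdx N) :
    pd σ (fun ξ : Phase N => ξ μ) = if σ = μ then 1 else 0 := by
  funext ξ
  have : fderiv ℝ (fun ξ : Phase N => ξ μ) ξ = ContinuousLinearMap.proj (R := ℝ) μ :=
    (ContinuousLinearMap.proj (R := ℝ) (φ := fun _ : PhaseIdx N => ℝ) μ).fderiv
  rw [pd, this]
  by_cases h : σ = μ
  · subst h; simp
  · simp [h]

theorem comp_fst_mem {g : (Fin N → ℝ) → ℝ} (hg : ContDiff ℝ ((⊤ : ℕ∞) : WithTop ℕ∞) g) :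
    (fun ξ : Phase N => g fun l => ξ (Sum.inl l)) ∈ smoothSubring N :=
  mem_smoothSubring.2
    (hg.comp (contDiff_pi.2 fun l => contDiff_apply ℝ ℝ (Sum.inl l : PhaseIdx N)))

theorem pd_comp_fst {g : (Fin N → ℝ) → ℝ} (hg : ContDiff ℝ ((⊤ : ℕ∞) : WithTop ℕ∞) g)
    (σ : PhaseIdx N) (ξ : Phase N) :
    pd σ (fun ξ : Phase N => g fun l => ξ (Sum.inl l)) ξ =
      Sum.elim (fun l => fderiv ℝ g (fun l => ξ (Sum.inl l)) (Pi.single l 1)) 0 σ := by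
  let L : Phase N →L[ℝ] (Fin N → ℝ) :=
    ContinuousLinearMap.pi fun l => ContinuousLinearMap.proj (R := ℝ) (Sum.inl l : PhaseIdx N)
  have h : HasFDerivAt (fun ξ : Phase N => g fun l => ξ (Sum.inl l))
      ((fderiv ℝ g (L ξ)).comp L) ξ :=
    (((hg.differentiable (by simp)) (L ξ)).hasFDerivAt).comp ξ L.hasFDerivAt
  rw [pd, h.fderiv]
  rcases σ with l | l
  · have : L (Pi.single (Sum.inl l) 1) = Pi.single l 1 := by
      ext k
      by_cases hk : k = l <;> simp [L, hk]
    simp only [ContinuousLinearMap.comp_apply, this]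
    rfl
  · have : L (Pi.single (Sum.inr l) 1) = 0 := by
      ext k
      simp [L]
    simp only [ContinuousLinearMap.comp_apply, this, map_zero]
    rfl

end PartialDerivatives

/-! ### Smoothness of integrals depending on a parameter. -/

section ParametricIntegral

variable {E F : Type} [NormedAddCommGroup E] [NormedSpace ℝ E]
  [NormedAddCommGroup F] [NormedSpace ℝ F]

theorem hasFDerivAt_intervalIntegral_of_contDiff [FiniteDimensional ℝ E] {H : E × ℝ → F} (hH : ContDiff ℝ 1 H)
    (a b : ℝ) (x₀ : E) :
    HasFDerivAt (fun x => ∫ t in a..b, H (x, t))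
      (∫ t in a..b, (fderiv ℝ H (x₀, t)).comp (ContinuousLinearMap.inl ℝ E ℝ)) x₀ := by
  have : ProperSpace E := FiniteDimensional.proper ℝ E
  have hc : Continuous fun q : E × ℝ => (fderiv ℝ H q).comp (ContinuousLinearMap.inl ℝ E ℝ) :=
    (hH.continuous_fderiv (by simp)).clm_comp continuous_const
  -- The closed unit ball around x₀ times the interval is compact, so a constant dominates the
  -- derivative there.
  obtain ⟨C, hC⟩ := ((isCompact_closedBall x₀ 1).prod (isCompact_uIcc (a := a)
    (b := b))).exists_bound_of_continuousOn hc.continuousOn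
  refine intervalIntegral.hasFDerivAt_integral_of_dominated_of_fderiv_le
    (F' := fun x t => (fderiv ℝ H (x, t)).comp (ContinuousLinearMap.inl ℝ E ℝ))
    (s := Metric.closedBall x₀ 1)
    (bound := fun _ => C) (Metric.closedBall_mem_nhds x₀ one_pos) ?_ ?_ ?_ ?_ ?_ ?_
  · exact Filter.Eventually.of_forall fun x =>
      (hH.continuous.comp (by fun_prop : Continuous fun t : ℝ => (x, t))).aestronglyMeasurable
  · exact (hH.continuous.comp (by fun_prop : Continuous fun t : ℝ => (x₀, t))).intervalIntegrable _ _
  · exact (hc.comp (by fun_prop : Continuous fun t : ℝ => (x₀, t))).aestronglyMeasurable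
  · exact Filter.Eventually.of_forall fun t ht x hx =>
      hC (x, t) ⟨hx, Set.uIoc_subset_uIcc ht⟩
  · exact intervalIntegrable_const
  · refine Filter.Eventually.of_forall fun t _ x _ => ?_
    exact ((hH.differentiable (by simp) (x, t)).hasFDerivAt).comp x (hasFDerivAt_prodMk_left x t)

theorem contDiff_fderiv_comp_inl {n : ℕ} {H : E × ℝ → F} (hH : ContDiff ℝ (n + 1 : ℕ) H) :
    ContDiff ℝ n fun q => (fderiv ℝ H q).comp (ContinuousLinearMap.inl ℝ E ℝ) :=
  (hH.fderiv_right (m := n) (by norm_cast)).clm_comp contDiff_const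

/-- Differentiation under the integral sign costs one order of smoothness. The target space is
quantified inside the induction because the derivative takes values in a space of linear maps. -/
theorem contDiff_nat_intervalIntegral [FiniteDimensional ℝ E] (n : ℕ) (a b : ℝ) : ∀ {F : Type} [NormedAddCommGroup F]
    [NormedSpace ℝ F] [CompleteSpace F] {H : E × ℝ → F}, ContDiff ℝ n H →
    ContDiff ℝ n fun x => ∫ t in a..b, H (x, t) := by
  induction n with
  | zero =>
    intro F _ _ _ H hH
    have hc : Continuous H := hH.continuous
    exact contDiff_zero.2 (intervalIntegral.continuous_parametric_intervalIntegral_of_continuous'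
      (f := fun x t => H (x, t)) hc a b)
  | succ n ih =>
    intro F _ _ _ H hH
    have h1 : ContDiff ℝ 1 H := hH.of_le (by norm_cast; omega)
    have hd := hasFDerivAt_intervalIntegral_of_contDiff h1 a b
    push_cast
    refine contDiff_succ_iff_fderiv.2 ⟨fun x => (hd x).differentiableAt, by simp, ?_⟩
    rw [show (fderiv ℝ fun x => ∫ t in a..b, H (x, t)) = _ from funext fun x => (hd x).fderiv]
    exact ih (contDiff_fderiv_comp_inl hH)

theorem contDiff_intervalIntegral [FiniteDimensional ℝ E] [CompleteSpace F] {H : E × ℝ → F}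
    (hH : ContDiff ℝ ((⊤ : ℕ∞) : WithTop ℕ∞) H) (a b : ℝ) :
    ContDiff ℝ ((⊤ : ℕ∞) : WithTop ℕ∞) fun x => ∫ t in a..b, H (x, t) :=
  contDiff_infty.2 fun n => contDiff_nat_intervalIntegral n a b (hH.of_le (by exact_mod_cast le_top))

theorem pd_intervalIntegral {N : ℕ} (σ : PhaseIdx N) {H : Phase N × ℝ → ℝ}
    (hH : ContDiff ℝ ((⊤ : ℕ∞) : WithTop ℕ∞) H) (a b : ℝ) (ξ : Phase N) :
    pd σ (fun ξ => ∫ t in a..b, H (ξ, t)) ξ = ∫ t in a..b, pd σ (fun ξ => H (ξ, t)) ξ := by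
  have h1 : ContDiff ℝ 1 H := hH.of_le (by exact_mod_cast le_top)
  have hc : Continuous fun q : Phase N × ℝ =>
      (fderiv ℝ H q).comp (ContinuousLinearMap.inl ℝ (Phase N) ℝ) :=
    (h1.continuous_fderiv (by simp)).clm_comp continuous_const
  rw [pd, (hasFDerivAt_intervalIntegral_of_contDiff h1 a b ξ).fderiv,
    ContinuousLinearMap.intervalIntegral_apply
      (φ := fun t => (fderiv ℝ H (ξ, t)).comp (ContinuousLinearMap.inl ℝ (Phase N) ℝ))
      ((hc.comp (by fun_prop : Continuous fun t : ℝ => (ξ, t))).intervalIntegrable _ _)]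
  refine intervalIntegral.integral_congr fun t _ => ?_
  have := HasFDerivAt.comp (g := H) (f := fun ξ : Phase N => (ξ, t)) ξ
    (h1.differentiable (by simp) (ξ, t)).hasFDerivAt (hasFDerivAt_prodMk_left ξ t)
  exact (congrArg (fun L => L (Pi.single σ 1)) this.fderiv).symm

end ParametricIntegral

/-! ### Scaling some of the coordinates, and the Poincaré lemma with parameters. -/

section PartialScaling

variable {N : ℕ} (c : PhaseIdx N → Prop) [DecidablePred c]

/-- The point obtained from `ξ` by multiplying the coordinates selected by `c` with `s`. -/
def scalePoint (s : ℝ) (ξ : Phase N) : Phase N := fun μ => if c μ then s * ξ μ else ξ μ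

/-- The point obtained from `ξ` by setting the coordinates not selected by `c` to zero. -/
def maskPoint (ξ : Phase N) : Phase N := fun μ => if c μ then ξ μ else 0

theorem scalePoint_one (ξ : Phase N) : scalePoint c 1 ξ = ξ := by
  funext μ
  simp [scalePoint]

theorem contDiff_scalePoint {n : WithTop ℕ∞} :
    ContDiff ℝ n fun q : Phase N × ℝ => scalePoint c q.2 q.1 := by
  refine contDiff_pi.2 fun μ => ?_
  by_cases h : c μ
  · simp only [scalePoint, h, if_true]
    fun_prop
  · simp only [scalePoint, h, if_false]
    fun_prop

theorem contDiff_comp_scalePoint {g : PhaseFn N} (hg : g ∈ smoothSubring N) :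
    ContDiff ℝ ((⊤ : ℕ∞) : WithTop ℕ∞) fun q : Phase N × ℝ => g (scalePoint c q.2 q.1) :=
  (mem_smoothSubring.1 hg).comp (contDiff_scalePoint c)

theorem comp_scalePoint_mem (s : ℝ) {g : PhaseFn N} (hg : g ∈ smoothSubring N) :
    (fun ξ => g (scalePoint c s ξ)) ∈ smoothSubring N :=
  mem_smoothSubring.2 ((contDiff_comp_scalePoint c hg).comp
    (by fun_prop : ContDiff ℝ _ fun ξ : Phase N => (ξ, s)))

theorem maskPoint_coord_mem (μ : PhaseIdx N) :
    (fun ξ : Phase N => maskPoint c ξ μ) ∈ smoothSubring N := by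
  by_cases h : c μ
  · simpa only [maskPoint, h, if_true] using coord_mem μ
  · simp only [maskPoint, h, if_false]
    exact (smoothSubring N).zero_mem

theorem pd_maskPoint_coord {ν : PhaseIdx N} (hν : c ν) (μ : PhaseIdx N) :
    pd ν (fun ξ : Phase N => maskPoint c ξ μ) = if ν = μ then 1 else 0 := by
  by_cases h : c μ
  · simpa only [maskPoint, h, if_true] using pd_coord ν μ
  · have : ν ≠ μ := by rintro rfl; exact h hν
    simpa only [maskPoint, h, this, if_false] using pd_const ν 0

theorem pd_comp_scalePoint (s : ℝ) {g : PhaseFn N} (hg : g ∈ smoothSubring N) {ν : PhaseIdx N}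
    (hν : c ν) (ξ : Phase N) :
    pd ν (fun ξ => g (scalePoint c s ξ)) ξ = s * pd ν g (scalePoint c s ξ) := by
  have hs : HasFDerivAt (scalePoint c s) (ContinuousLinearMap.pi fun μ =>
      (if c μ then s else 1) • ContinuousLinearMap.proj (R := ℝ) (φ := fun _ : PhaseIdx N => ℝ) μ)
      ξ := by
    refine hasFDerivAt_pi.2 fun μ => ?_
    have h := (ContinuousLinearMap.proj (R := ℝ) (φ := fun _ : PhaseIdx N => ℝ) μ).hasFDerivAt
      (x := ξ)
    by_cases hμ : c μ
    · simpa only [scalePoint, hμ, if_true, smul_eq_mul] using! h.const_smul s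
    · simpa only [scalePoint, hμ, if_false, one_smul] using! h
  have h := (differentiable_of_mem hg (scalePoint c s ξ)).hasFDerivAt.comp ξ hs
  have h' : pd ν (fun ξ => g (scalePoint c s ξ)) ξ = _ :=
    congrArg (fun L => L (Pi.single ν 1)) h.fderiv
  rw [h', ContinuousLinearMap.comp_apply, fderiv_eq_sum_pd, Finset.sum_eq_single ν]
  · simp [hν]
  · intro μ _ hμ
    rw [ContinuousLinearMap.pi_apply, smul_apply,
      ContinuousLinearMap.proj_apply, Pi.single_eq_of_ne hμ, smul_zero, zero_mul]
  · simp

/-- Chain rule along the path, whose velocity is the constant vector `maskPoint c ξ`. -/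
theorem hasDerivAt_comp_scalePoint {g : PhaseFn N} (hg : g ∈ smoothSubring N) (ξ : Phase N)
    (s : ℝ) :
    HasDerivAt (fun s => g (scalePoint c s ξ))
      (∑ μ, maskPoint c ξ μ * pd μ g (scalePoint c s ξ)) s := by
  have hs : HasDerivAt (fun s => scalePoint c s ξ) (maskPoint c ξ) s := by
    refine hasDerivAt_pi.2 fun μ => ?_
    by_cases hμ : c μ
    · simpa only [scalePoint, maskPoint, hμ, if_true] using hasDerivAt_mul_const (ξ μ)
    · simpa only [scalePoint, maskPoint, hμ, if_false] using hasDerivAt_const s (ξ μ)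
  rw [← fderiv_eq_sum_pd]
  exact (differentiable_of_mem hg (scalePoint c s ξ)).hasFDerivAt.comp_hasDerivAt s hs

/-- The fundamental theorem of calculus for `s^{k+1} g` along the partial scaling. -/
theorem integral_deriv_pow_mul_comp_scalePoint (k : ℕ) {g : PhaseFn N} (hg : g ∈ smoothSubring N)
    (ξ : Phase N) :
    ∫ s in (0 : ℝ)..1, ((k + 1) * s ^ k * g (scalePoint c s ξ) +
      s ^ (k + 1) * ∑ μ, maskPoint c ξ μ * pd μ g (scalePoint c s ξ)) = g ξ := by
  have hcont : ∀ h ∈ smoothSubring N, Continuous fun s : ℝ => h (scalePoint c s ξ) :=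
    fun h hh => (contDiff_comp_scalePoint c hh).continuous.comp
      (by fun_prop : Continuous fun s : ℝ => (ξ, s))
  have h := intervalIntegral.integral_eq_sub_of_hasDerivAt (a := 0) (b := 1)
    (fun s _ => (hasDerivAt_pow (k + 1) s).mul (hasDerivAt_comp_scalePoint c hg ξ s)) ?_
  · simpa [scalePoint_one] using h
  · refine Continuous.intervalIntegrable ?_ _ _
    have h1 := hcont g hg
    have h2 := fun μ => hcont _ (pd_mem μ hg)
    exact ((continuous_const.mul (continuous_pow _)).mul h1).add
      ((continuous_pow _).mul (continuous_finsetSum _ fun μ _ => continuous_const.mul (h2 μ)))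

/-- The Poincaré lemma in the coordinates selected by `c`, the others being parameters. -/
theorem exists_pd_eq_of_closed {u : PhaseIdx N → PhaseFn N} (hu : ∀ μ, u μ ∈ smoothSubring N)
    (hclosed : ∀ μ ν, c μ → c ν → pd μ (u ν) = pd ν (u μ)) :
    ∃ f ∈ smoothSubring N, ∀ μ, c μ → pd μ f = u μ := by
  have hH : ContDiff ℝ ((⊤ : ℕ∞) : WithTop ℕ∞) fun q : Phase N × ℝ =>
      ∑ μ, maskPoint c q.1 μ * u μ (scalePoint c q.2 q.1) :=
    ContDiff.sum fun μ _ => ((mem_smoothSubring.1 (maskPoint_coord_mem c μ)).comp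
      contDiff_fst).mul (contDiff_comp_scalePoint c (hu μ))
  -- The witness is the homotopy integral ∫₀¹ Σ ξ_μ u_μ(scaled ξ) ds over the selected μ. Closedness
  -- will turn its ν-derivative into the integral of d/ds (s u_ν), the case k = 0 of the previous
  -- theorem.
  refine ⟨_, mem_smoothSubring.2 (contDiff_intervalIntegral hH 0 1), fun ν hν => ?_⟩
  funext ξ
  rw [pd_intervalIntegral ν hH, ← integral_deriv_pow_mul_comp_scalePoint c 0 (hu ν) ξ]
  refine intervalIntegral.integral_congr fun s _ => ?_
  have hterm : ∀ μ, (fun ξ => maskPoint c ξ μ) * (fun ξ => u μ (scalePoint c s ξ)) ∈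
      smoothSubring N := fun μ =>
    mul_mem (maskPoint_coord_mem c μ) (comp_scalePoint_mem c s (hu μ))
  have hsum : (fun ξ => ∑ μ, maskPoint c ξ μ * u μ (scalePoint c s ξ)) =
      ∑ μ, (fun ξ => maskPoint c ξ μ) * (fun ξ => u μ (scalePoint c s ξ)) := by
    funext ξ
    simp
  change pd ν (fun ξ => ∑ μ, maskPoint c ξ μ * u μ (scalePoint c s ξ)) ξ = _
  rw [hsum, pd_sum ν _ fun μ _ => hterm μ, Finset.sum_apply]
  have hpd : ∀ μ, pd ν ((fun ξ => maskPoint c ξ μ) * fun ξ => u μ (scalePoint c s ξ)) ξ =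
      s * (maskPoint c ξ μ * pd μ (u ν) (scalePoint c s ξ)) +
        (if ν = μ then u ν (scalePoint c s ξ) else 0) := by
    intro μ
    rw [pd_mul ν (maskPoint_coord_mem c μ) (comp_scalePoint_mem c s (hu μ)),
      pd_maskPoint_coord c hν, Pi.add_apply, Pi.mul_apply, Pi.mul_apply,
      pd_comp_scalePoint c s (hu μ) hν]
    congr 1
    · by_cases hμ : c μ
      · rw [hclosed ν μ hν hμ]
        ring
      · simp [maskPoint, hμ]
    · split_ifs with h
      · subst h
        simp
      · simp
  rw [Finset.sum_congr rfl fun μ _ => hpd μ, Finset.sum_add_distrib, ← Finset.mul_sum]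
  simp
  ring

end PartialScaling

/-! ### The homotopy solution of the curl equation in the momenta. -/

section RadialSolution

variable {N : ℕ}

theorem radialSolution_eq (G : Fin N → Fin N → PhaseFn N) (i : Fin N) :
    radialSolution G i = fun ξ => ∫ s in (0 : ℝ)..1, ∑ j, s * ξ (Sum.inr j) *
      G j i (scalePoint (fun μ => μ.isRight) s ξ) := by
  funext ξ
  rw [radialSolution]
  refine intervalIntegral.integral_congr fun s _ => Finset.sum_congr rfl fun j _ => ?_
  congr 2
  funext μ
  rcases μ with l | l <;> simp [scalePoint]

theorem contDiff_radialIntegrand {G : Fin N → Fin N → PhaseFn N}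
    (hG : ∀ i j, G i j ∈ smoothSubring N) (i : Fin N) :
    ContDiff ℝ ((⊤ : ℕ∞) : WithTop ℕ∞) fun q : Phase N × ℝ =>
      ∑ j, q.2 * q.1 (Sum.inr j) * G j i (scalePoint (fun μ => μ.isRight) q.2 q.1) :=
  ContDiff.sum fun j _ => (contDiff_snd.mul ((mem_smoothSubring.1 (coord_mem (Sum.inr j))).comp
    contDiff_fst)).mul (contDiff_comp_scalePoint _ (hG j i))

theorem radialSolution_mem {G : Fin N → Fin N → PhaseFn N}
    (hG : ∀ i j, G i j ∈ smoothSubring N) (i : Fin N) :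
    radialSolution G i ∈ smoothSubring N := by
  rw [radialSolution_eq]
  exact mem_smoothSubring.2 (contDiff_intervalIntegral (contDiff_radialIntegrand hG i) 0 1)

theorem radialSolution_zero (i : Fin N) :
    radialSolution (fun _ _ => (0 : PhaseFn N)) i = 0 := by
  funext ξ
  simp [radialSolution]

theorem pd_radialSolution {G : Fin N → Fin N → PhaseFn N}
    (hG : ∀ i j, G i j ∈ smoothSubring N) (i k : Fin N) (ξ : Phase N) :
    pd (Sum.inr k) (radialSolution G i) ξ = ∫ s in (0 : ℝ)..1,
      (s * G k i (scalePoint (fun μ => μ.isRight) s ξ) + s ^ 2 * ∑ j, ξ (Sum.inr j) *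
        pd (Sum.inr k) (G j i) (scalePoint (fun μ => μ.isRight) s ξ)) := by
  rw [radialSolution_eq, pd_intervalIntegral _ (contDiff_radialIntegrand hG i)]
  refine intervalIntegral.integral_congr fun s _ => ?_
  set S := scalePoint (N := N) (fun μ => μ.isRight) s with hS
  have hterm : ∀ j, (fun ξ => G j i (S ξ)) ∈ smoothSubring N := fun j =>
    comp_scalePoint_mem _ s (hG j i)
  have hs : (fun _ => s) ∈ smoothSubring N := mem_smoothSubring.2 contDiff_const
  have hsum : (fun ξ => ∑ j, s * ξ (Sum.inr j) * G j i (S ξ)) =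
      ∑ j, ((fun _ => s) * fun ξ => ξ (Sum.inr j)) * (fun ξ => G j i (S ξ)) := by
    funext ξ
    simp
  change pd (Sum.inr k) (fun ξ => ∑ j, s * ξ (Sum.inr j) * G j i (S ξ)) ξ = _
  rw [hsum, pd_sum _ _ fun j _ => mul_mem (mul_mem hs (coord_mem _)) (hterm j), Finset.sum_apply]
  have hpd : ∀ j, pd (Sum.inr k) (((fun _ => s) * fun ξ => ξ (Sum.inr j)) *
      fun ξ => G j i (S ξ)) ξ =
      s ^ 2 * (ξ (Sum.inr j) * pd (Sum.inr k) (G j i) (S ξ)) +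
        (if k = j then s * G k i (S ξ) else 0) := by
    intro j
    rw [pd_mul _ (mul_mem hs (coord_mem _)) (hterm j), pd_mul _ hs (coord_mem _), pd_const,
      pd_coord, Pi.add_apply, Pi.mul_apply, hS, pd_comp_scalePoint (fun μ => μ.isRight) s (hG j i) rfl]
    congr 1
    · simp only [Pi.mul_apply]
      ring
    · by_cases h : k = j
      · subst h
        simp
      · simp [h]
  rw [Finset.sum_congr rfl fun j _ => hpd j, Finset.sum_add_distrib, ← Finset.mul_sum]
  simp
  ring

/-- For antisymmetric `G` that is closed in the momenta, `radialSolution G` is a potential. -/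
theorem curl_radialSolution {G : Fin N → Fin N → PhaseFn N}
    (hG : ∀ i j, G i j ∈ smoothSubring N) (hanti : ∀ i j, G i j = -G j i)
    (hclosed : ∀ i j k, pd (Sum.inr k) (G i j) + pd (Sum.inr i) (G j k)
      + pd (Sum.inr j) (G k i) = 0) (i j : Fin N) :
    pd (Sum.inr i) (radialSolution G j) - pd (Sum.inr j) (radialSolution G i) = G i j := by
  funext ξ
  have hint : ∀ i k : Fin N, IntervalIntegrable (fun s : ℝ =>
      (s * G k i (scalePoint (fun μ => μ.isRight) s ξ) + s ^ 2 * ∑ j, ξ (Sum.inr j) *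
        pd (Sum.inr k) (G j i) (scalePoint (fun μ => μ.isRight) s ξ)))
      MeasureTheory.volume 0 1 := by
    intro i k
    have hcont : ∀ h ∈ smoothSubring N,
        Continuous fun s : ℝ => h (scalePoint (fun μ => μ.isRight) s ξ) :=
      fun h hh => (contDiff_comp_scalePoint _ hh).continuous.comp
        (by fun_prop : Continuous fun s : ℝ => (ξ, s))
    have h1 := hcont _ (hG k i)
    have h2 := fun j => hcont _ (pd_mem (Sum.inr k) (hG j i))
    exact ((continuous_id.mul h1).add ((continuous_pow _).mul
      (continuous_finsetSum _ fun j _ => continuous_const.mul (h2 j)))).intervalIntegrable _ _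
  rw [Pi.sub_apply, pd_radialSolution hG, pd_radialSolution hG,
    ← intervalIntegral.integral_sub (hint j i) (hint i j),
    ← integral_deriv_pow_mul_comp_scalePoint (fun μ => μ.isRight) 1 (hG i j) ξ]
  refine intervalIntegral.integral_congr fun s _ => ?_
  set η := scalePoint (N := N) (fun μ => μ.isRight) s ξ
  -- Antisymmetry and closedness of G combine the two sums into the radial derivative of G_{ij}; the
  -- integrand is then d/ds (s² G_{ij}), hence k = 1.
  have hsum : ∑ k, ξ (Sum.inr k) * pd (Sum.inr i) (G k j) η -
      ∑ k, ξ (Sum.inr k) * pd (Sum.inr j) (G k i) η =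
      ∑ μ, maskPoint (fun μ => μ.isRight) ξ μ * pd μ (G i j) η := by
    rw [Fintype.sum_sum_type, ← Finset.sum_sub_distrib]
    simp only [maskPoint, Sum.isRight_inl, Sum.isRight_inr, if_true, Bool.false_eq_true, if_false,
      zero_mul, Finset.sum_const_zero, zero_add]
    refine Finset.sum_congr rfl fun k _ => ?_
    have h1 := congrFun (hclosed i j k) η
    rw [hanti j k, pd_neg] at h1
    simp only [Pi.add_apply, Pi.neg_apply, Pi.zero_apply] at h1
    linear_combination (-ξ (Sum.inr k)) * h1
  have h2 := congrFun (hanti j i) η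
  rw [Pi.neg_apply] at h2
  change s * G i j η + s ^ 2 * ∑ k, ξ (Sum.inr k) * pd (Sum.inr i) (G k j) η -
    (s * G j i η + s ^ 2 * ∑ k, ξ (Sum.inr k) * pd (Sum.inr j) (G k i) η) =
    ((1 : ℕ) + 1) * s ^ 1 * G i j η + s ^ 2 *
      ∑ μ, maskPoint (fun μ => μ.isRight) ξ μ * pd μ (G i j) η
  rw [← hsum, h2]
  push_cast
  ring

end RadialSolution

/-! ### Combinatorics of compositions. -/

section Compositions

/-- Splitting off the first block. This is the coefficient form of 1/(1 − g) = 1 + g · 1/(1 − g),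
where g has no constant term; hence the shift p.1 + 1. -/
theorem sum_composition_succ {R : Type*} [Semiring R] (g : ℕ → R) (n : ℕ) :
    ∑ c : Composition (n + 1), (c.blocks.map g).prod =
      ∑ p ∈ Finset.HasAntidiagonal.antidiagonal n,
        g (p.1 + 1) * ∑ c : Composition p.2, (c.blocks.map g).prod := by
  simp only [Finset.mul_sum]
  rw [Finset.sum_sigma']
  symm
  refine Finset.sum_bij (fun (x : Σ p : ℕ × ℕ, Composition p.2) hx =>
    (⟨(x.1.1 + 1) :: x.2.blocks, ?_, ?_⟩ : Composition (n + 1))) ?_ ?_ ?_ ?_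
  · intro i hi
    rcases List.mem_cons.1 hi with rfl | hi
    · exact Nat.succ_pos _
    · exact x.2.blocks_pos hi
  · have := Finset.HasAntidiagonal.mem_antidiagonal.1 (Finset.mem_sigma.1 hx).1
    rw [List.sum_cons, x.2.blocks_sum]
    omega
  · simp
  · rintro ⟨⟨a, b⟩, c⟩ hx ⟨⟨a', b'⟩, c'⟩ hx' h
    have h1 := Finset.HasAntidiagonal.mem_antidiagonal.1 (Finset.mem_sigma.1 hx).1
    have h2 := Finset.HasAntidiagonal.mem_antidiagonal.1 (Finset.mem_sigma.1 hx').1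
    simp only [Composition.mk.injEq, List.cons.injEq, Nat.add_right_cancel_iff] at h h1 h2
    obtain ⟨rfl, hc⟩ := h
    obtain rfl : b = b' := by omega
    obtain rfl : c = c' := Composition.ext hc
    rfl
  · intro c _
    obtain ⟨bs, hpos, hsum⟩ := c
    rcases bs with _ | ⟨m, l⟩
    · simp at hsum
    · have hm : 0 < m := hpos (by simp)
      rw [List.sum_cons] at hsum
      refine ⟨⟨(m - 1, l.sum), ⟨l, fun hi => hpos (List.mem_cons_of_mem _ hi), rfl⟩⟩, ?_, ?_⟩
      · simp only [Finset.mem_sigma, Finset.HasAntidiagonal.mem_antidiagonal, Finset.mem_univ, and_true]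
        omega
      · simp only [Composition.mk.injEq, List.cons.injEq, and_true]
        omega
  · intro x _
    simp

theorem prod_intersperse_mul {R : Type*} [Monoid R] (k : R) : ∀ {l : List R}, l ≠ [] →
    (l.intersperse k).prod * k = (l.map (· * k)).prod
  | [], h => absurd rfl h
  | [a], _ => by simp
  | a :: b :: l, _ => by
    have := prod_intersperse_mul k (l := b :: l) (by simp)
    rw [List.intersperse_cons_cons, List.prod_cons, List.prod_cons, List.map_cons, List.prod_cons,
      ← this]
    simp only [mul_assoc]

/-- A block equal to n would leave nothing for the other blocks, which are positive. This makes S^n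
depend on lower orders only, and so makes the recursion well founded. -/
theorem Composition.lt_of_mem_blocks {n m : ℕ} (c : Composition n) (hc : 2 ≤ c.length)
    (hm : m ∈ c.blocks) : m < n := by
  refine lt_of_le_of_ne (c.blocks_le hm) fun h => ?_
  subst h
  have hperm := List.perm_cons_erase hm
  have hs := hperm.sum_eq
  rw [c.blocks_sum, List.sum_cons] at hs
  have hl := hperm.length_eq
  rw [c.blocks_length, List.length_cons] at hl
  obtain ⟨b, hb⟩ := List.exists_mem_of_length_pos (l := c.blocks.erase m) (by omega)
  have := List.le_sum_of_mem hb
  have := c.blocks_pos (List.mem_of_mem_erase hb)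
  omega

end Compositions

/-! ### Coefficients of matrices of formal power series. -/

section MatrixCoefficients

variable {N : ℕ}

/-- Square matrices over phase space functions. -/
abbrev PhaseMatrix (N : ℕ) : Type := Matrix (PhaseIdx N) (PhaseIdx N) (PhaseFn N)

/-- Square matrices of formal power series. -/
abbrev SeriesMatrix (N : ℕ) : Type := Matrix (PhaseIdx N) (PhaseIdx N) (PhaseSeries N)

theorem matCoeff_apply (n : ℕ) (M : SeriesMatrix N) (μ ν : PhaseIdx N) :
    matCoeff n M μ ν = PowerSeries.coeff n (M μ ν) := rfl

theorem seriesMatrix_ext {A B : SeriesMatrix N} (h : ∀ n, matCoeff n A = matCoeff n B) :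
    A = B := by
  ext μ ν : 1
  exact PowerSeries.ext fun n => congrFun (congrFun (h n) μ) ν

theorem matCoeff_mul (n : ℕ) (A B : SeriesMatrix N) :
    matCoeff n (A * B) = ∑ p ∈ Finset.HasAntidiagonal.antidiagonal n, matCoeff p.1 A * matCoeff p.2 B := by
  ext μ ν : 1
  simp only [matCoeff_apply, Matrix.mul_apply, Matrix.sum_apply, map_sum, PowerSeries.coeff_mul]
  exact Finset.sum_comm

theorem matCoeff_neg (n : ℕ) (A : SeriesMatrix N) : matCoeff n (-A) = -matCoeff n A := by
  ext μ ν : 1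
  simp [matCoeff_apply]

theorem matCoeff_one (n : ℕ) :
    matCoeff n (1 : SeriesMatrix N) = if n = 0 then 1 else 0 := by
  ext μ ν : 1
  by_cases h : μ = ν
  · subst h
    rw [matCoeff_apply, Matrix.one_apply_eq, PowerSeries.coeff_one]
    split_ifs <;> simp
  · rw [matCoeff_apply, Matrix.one_apply_ne h, map_zero]
    split_ifs
    · rw [Matrix.one_apply_ne h]
    · rfl

/-- The matrix of formal power series with given coefficients. -/
def matSeries (W : ℕ → PhaseMatrix N) : SeriesMatrix N :=
  Matrix.of fun μ ν => PowerSeries.mk fun n => W n μ ν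

theorem matCoeff_matSeries (W : ℕ → PhaseMatrix N) (n : ℕ) : matCoeff n (matSeries W) = W n := by
  ext μ ν : 1
  simp [matCoeff_apply, matSeries]

theorem canonMatrix_mul_self : canonMatrix N * canonMatrix N = -1 := by
  rw [canonMatrix, Matrix.fromBlocks_multiply, ← Matrix.fromBlocks_one, Matrix.fromBlocks_neg]
  simp

theorem canonMatrix_mul_cancel (A : PhaseMatrix N) :
    canonMatrix N * (canonMatrix N * A) = -A := by
  rw [← mul_assoc, canonMatrix_mul_self, neg_one_mul]

/-- The smooth matrices, as a subring. -/
def smoothMatrix (N : ℕ) : Subring (PhaseMatrix N) where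
  carrier := {M | ∀ μ ν, M μ ν ∈ smoothSubring N}
  mul_mem' := fun {A B} hA hB => by
    rw [Set.mem_ofPred] at *
    intro μ ν
    rw [Matrix.mul_apply]
    exact sum_mem fun σ _ => mul_mem (hA μ σ) (hB σ ν)
  one_mem' := by
    rw [Set.mem_ofPred]
    intro μ ν
    rw [Matrix.one_apply]
    split_ifs
    · exact one_mem _
    · exact zero_mem _
  add_mem' := fun {A B} hA hB => by
    rw [Set.mem_ofPred] at *
    exact fun μ ν => add_mem (hA μ ν) (hB μ ν)
  zero_mem' := by
    rw [Set.mem_ofPred]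
    exact fun μ ν => zero_mem _
  neg_mem' := fun {A} hA => by
    rw [Set.mem_ofPred] at *
    exact fun μ ν => neg_mem (hA μ ν)

theorem mem_smoothMatrix {M : PhaseMatrix N} :
    M ∈ smoothMatrix N ↔ ∀ μ ν, M μ ν ∈ smoothSubring N := Iff.rfl

theorem canonMatrix_mem : canonMatrix N ∈ smoothMatrix N := by
  rw [mem_smoothMatrix, canonMatrix]
  rintro (i | i) (j | j)
  · exact zero_mem _
  · rw [Matrix.fromBlocks_apply₁₂, Matrix.one_apply]
    split_ifs
    · exact one_mem _
    · exact zero_mem _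
  · rw [Matrix.fromBlocks_apply₂₁, Matrix.neg_apply, Matrix.one_apply]
    split_ifs
    · exact neg_mem (one_mem _)
    · exact neg_mem (zero_mem _)
  · exact zero_mem _

end MatrixCoefficients

/-! ### The geometric series for the inverse and the equation of order n. -/

section Chains

variable {N : ℕ}

theorem chainSum_congr {A B : SeriesMatrix N} {n : ℕ}
    (h : ∀ m < n, matCoeff m A = matCoeff m B) : chainSum A n = chainSum B n := by
  refine Finset.sum_congr rfl fun c hc => ?_
  rw [List.map_congr_left fun m hm =>
    h m (c.lt_of_mem_blocks (Finset.mem_filter.1 hc).2 hm)]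

theorem chainSum_of_lt_two (A : SeriesMatrix N) {n : ℕ} (hn : n < 2) : chainSum A n = 0 := by
  refine Finset.sum_eq_zero fun c hc => absurd (Finset.mem_filter.1 hc).2 ?_
  have := c.length_le
  omega

theorem chainSum_mem {A : SeriesMatrix N} {n : ℕ}
    (h : ∀ m < n, matCoeff m A ∈ smoothMatrix N) : chainSum A n ∈ smoothMatrix N := by
  refine sum_mem fun c hc => list_prod_mem fun M hM => ?_
  have key : ∀ (l : List (PhaseMatrix N)), (∀ M ∈ l, M ∈ smoothMatrix N) →
      ∀ M ∈ l.intersperse (canonMatrix N), M ∈ smoothMatrix N := by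
    intro l
    induction l with
    | nil => simp
    | cons a l ih =>
      intro hl M hM
      rcases l with _ | ⟨b, l⟩
      · exact hl M (by simpa using hM)
      · rw [List.intersperse_cons_cons, List.mem_cons, List.mem_cons] at hM
        rcases hM with rfl | rfl | hM
        · exact hl _ (by simp)
        · exact canonMatrix_mem
        · exact ih (fun M hM => hl M (List.mem_cons_of_mem _ hM)) M hM
  refine key _ (fun M hM => ?_) M hM
  obtain ⟨m, hm, rfl⟩ := List.mem_map.1 hM
  exact h m (c.lt_of_mem_blocks (Finset.mem_filter.1 hc).2 hm)

/-- The sum of the products `Ω^{m₁} Ω⁰ ⋯ Ω^{m_k} Ω⁰` over all compositions of `n`. -/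
def chainTotal (Om : SeriesMatrix N) (n : ℕ) : PhaseMatrix N :=
  ∑ c : Composition n, (c.blocks.map fun m => matCoeff m Om * canonMatrix N).prod

theorem chainTotal_zero (Om : SeriesMatrix N) : chainTotal Om 0 = 1 := by
  have h : ∀ c : Composition 0, c.blocks = [] := fun c => c.blocks_eq_nil.2 rfl
  rw [chainTotal, Fintype.sum_congr _ (fun _ => 1) fun c => by rw [h c]; rfl]
  simp [composition_card]

/-- The one-block composition gives Ω^n. In the others, the interspersed factors Ω⁰ together with
the trailing one supply a factor Ω⁰ after every block. -/
theorem chainTotal_eq (Om : SeriesMatrix N) {n : ℕ} (hn : 1 ≤ n) :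
    chainTotal Om n = (matCoeff n Om + chainSum Om n) * canonMatrix N := by
  rw [chainTotal, ← Finset.sum_filter_add_sum_filter_not _ fun c : Composition n => 2 ≤ c.length,
    add_mul, add_comm, chainSum, Finset.sum_mul]
  congr 1
  · have : (Finset.univ.filter fun c : Composition n => ¬ 2 ≤ c.length) =
        {Composition.single n hn} := by
      ext c
      have := c.length_pos_of_pos hn
      rw [Finset.mem_filter, Finset.mem_singleton, Composition.eq_single_iff_length hn]
      simp only [Finset.mem_univ, true_and]
      omega
    rw [this, Finset.sum_singleton, Composition.single_blocks]
    simp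
  · refine Finset.sum_congr rfl fun c hc => ?_
    rw [prod_intersperse_mul, List.map_map]
    · rfl
    · intro h
      have h1 := (Finset.mem_filter.1 hc).2
      rw [← c.blocks_length, ← List.length_map (fun m => matCoeff m Om), h] at h1
      simp at h1

/-- The inverse of a series of matrices with leading term `Ω⁰`, as a geometric series. -/
def chainInverse (Om : SeriesMatrix N) : SeriesMatrix N :=
  matSeries fun n => -(canonMatrix N * chainTotal Om n)

/-- The recursion from the first block cancels the term of Ω⁰ against the terms of all higher Ω^m.
-/
theorem mul_chainInverse {Om : SeriesMatrix N} (h0 : matCoeff 0 Om = canonMatrix N) :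
    Om * chainInverse Om = 1 := by
  refine seriesMatrix_ext fun n => ?_
  rw [matCoeff_mul, matCoeff_one, chainInverse]
  simp only [matCoeff_matSeries]
  rcases n with _ | n
  · simp [h0, chainTotal_zero, canonMatrix_mul_self]
  · rw [Finset.Nat.antidiagonal_succ, Finset.sum_cons, Finset.sum_map, h0, if_neg (by simp)]
    have h := sum_composition_succ (fun m => matCoeff m Om * canonMatrix N) n
    change chainTotal Om (n + 1) = ∑ p ∈ Finset.HasAntidiagonal.antidiagonal n,
      matCoeff (p.1 + 1) Om * canonMatrix N * chainTotal Om p.2 at h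
    rw [mul_neg, canonMatrix_mul_cancel, neg_neg, h, ← Finset.sum_add_distrib]
    refine Finset.sum_eq_zero fun p _ => ?_
    simp [mul_assoc]

theorem matCoeff_chainInverse_zero (Om : SeriesMatrix N) :
    matCoeff 0 (chainInverse Om) = -canonMatrix N := by
  rw [chainInverse, matCoeff_matSeries, chainTotal_zero, mul_one]

theorem matCoeff_chainInverse (Om : SeriesMatrix N) {n : ℕ} (hn : 1 ≤ n) :
    matCoeff n (chainInverse Om) =
      -(canonMatrix N * (matCoeff n Om + chainSum Om n) * canonMatrix N) := by
  rw [chainInverse, matCoeff_matSeries, chainTotal_eq Om hn, mul_assoc]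

theorem matCoeff_chainInverse_mem {Om : SeriesMatrix N}
    (h : ∀ m, matCoeff m Om ∈ smoothMatrix N) (n : ℕ) :
    matCoeff n (chainInverse Om) ∈ smoothMatrix N := by
  rcases n.eq_zero_or_pos with rfl | hn
  · rw [matCoeff_chainInverse_zero]
    exact neg_mem canonMatrix_mem
  · rw [matCoeff_chainInverse Om hn]
    exact neg_mem (mul_mem (mul_mem canonMatrix_mem (add_mem (h n)
      (chainSum_mem fun m _ => h m))) canonMatrix_mem)

/-- The order `n` part of the equation `B Ω = 1`, solved for `Ω^n`. -/
theorem matCoeff_mul_eq_one_iff {B Om : SeriesMatrix N} (h0 : matCoeff 0 Om = canonMatrix N)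
    {n : ℕ} (hn : 1 ≤ n) (hlow : ∀ m < n, matCoeff m (B * Om) = matCoeff m 1) :
    matCoeff n (B * Om) = matCoeff n 1 ↔
      matCoeff n Om = -(canonMatrix N * matCoeff n B * canonMatrix N) - chainSum Om n := by
  obtain ⟨k, rfl⟩ : ∃ k, n = k + 1 := ⟨n - 1, by omega⟩
  -- With E the order k + 1 coefficient of BΩ, orders 1 to k of BΩ vanish, so B and Ω⁻¹ differ at
  -- order k + 1 only by EΩ⁰. The right-hand side of the claim then equals Ω^{k+1} − Ω⁰E, and Ω⁰ is
  -- invertible.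
  have hB : B = B * Om * chainInverse Om := by rw [mul_assoc, mul_chainInverse h0, mul_one]
  set E := matCoeff (k + 1) (B * Om) with hE
  have hBn : matCoeff (k + 1) B = matCoeff (k + 1) (chainInverse Om) - E * canonMatrix N := by
    rw [hB, matCoeff_mul, Finset.Nat.antidiagonal_succ', Finset.sum_cons, Finset.sum_map,
      Finset.sum_eq_single_of_mem (0, k) (by simp)]
    · change E * matCoeff 0 (chainInverse Om) +
        matCoeff 0 (B * Om) * matCoeff (k + 1) (chainInverse Om) = _
      rw [hlow 0 (Nat.succ_pos k), matCoeff_one, if_pos rfl, matCoeff_chainInverse_zero, one_mul,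
        mul_neg]
      abel
    · rintro ⟨a, b⟩ hp hne
      have hab := Finset.HasAntidiagonal.mem_antidiagonal.1 hp
      simp only at hab
      have ha : a ≠ 0 := by
        rintro rfl
        exact hne (by rw [← hab, zero_add])
      change matCoeff a (B * Om) * _ = 0
      rw [hlow a (by omega), matCoeff_one, if_neg ha, zero_mul]
  have hKBK : -(canonMatrix N * matCoeff (k + 1) B * canonMatrix N) - chainSum Om (k + 1) =
      matCoeff (k + 1) Om - canonMatrix N * E := by
    rw [hBn, matCoeff_chainInverse Om hn]
    simp only [mul_sub, sub_mul, mul_neg, mul_assoc, canonMatrix_mul_cancel,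
      canonMatrix_mul_self, mul_one, neg_neg]
    abel
  rw [hKBK, matCoeff_one, if_neg (Nat.succ_ne_zero k)]
  constructor
  · intro h
    rw [h, mul_zero, sub_zero]
  · intro h
    have h1 : canonMatrix N * E = 0 := sub_eq_self.1 h.symm
    have h2 := canonMatrix_mul_cancel E
    rw [h1, mul_zero] at h2
    exact neg_eq_zero.1 h2.symm

end Chains

/-! ### Derivatives of formal power series and the identity d² = 0. -/

section SeriesDerivatives

variable {N : ℕ}

theorem forall_smoothSeries_iff {Om : SeriesMatrix N} :
    (∀ μ ν, SmoothSeries (Om μ ν)) ↔ ∀ n, matCoeff n Om ∈ smoothMatrix N :=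
  ⟨fun h n μ ν => h μ ν n, fun h μ ν n => h n μ ν⟩

theorem coeff_sd (n : ℕ) (σ : PhaseIdx N) (F : PhaseSeries N) :
    PowerSeries.coeff n (sd σ F) = pd σ (PowerSeries.coeff n F) := by
  rw [sd, PowerSeries.coeff_mk]

theorem SmoothSeries.sd {F : PhaseSeries N} (hF : SmoothSeries F) (σ : PhaseIdx N) :
    SmoothSeries (sd σ F) := fun n => by
  rw [coeff_sd]
  exact pd_mem σ (hF n)

theorem SmoothSeries.sub {F G : PhaseSeries N} (hF : SmoothSeries F) (hG : SmoothSeries G) :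
    SmoothSeries (F - G) := fun n => by
  rw [map_sub]
  exact (smoothSubring N).sub_mem (hF n) (hG n)

theorem SmoothSeries.mul {F G : PhaseSeries N} (hF : SmoothSeries F) (hG : SmoothSeries G) :
    SmoothSeries (F * G) := fun n => by
  rw [PowerSeries.coeff_mul]
  exact (smoothSubring N).sum_mem fun p _ => mul_mem (hF p.1) (hG p.2)

theorem sd_sub (σ : PhaseIdx N) {F G : PhaseSeries N} (hF : SmoothSeries F)
    (hG : SmoothSeries G) : sd σ (F - G) = sd σ F - sd σ G := by
  refine PowerSeries.ext fun n => ?_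
  rw [coeff_sd, map_sub, map_sub, pd_sub σ (hF n) (hG n), coeff_sd, coeff_sd]

theorem sd_sum (σ : PhaseIdx N) {ι : Type*} (s : Finset ι) {F : ι → PhaseSeries N}
    (hF : ∀ i ∈ s, SmoothSeries (F i)) : sd σ (∑ i ∈ s, F i) = ∑ i ∈ s, sd σ (F i) := by
  refine PowerSeries.ext fun n => ?_
  rw [coeff_sd, map_sum, map_sum, pd_sum σ s fun i hi => hF i hi n]
  exact Finset.sum_congr rfl fun i _ => (coeff_sd n σ (F i)).symm

theorem sd_mul (σ : PhaseIdx N) {F G : PhaseSeries N} (hF : SmoothSeries F)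
    (hG : SmoothSeries G) : sd σ (F * G) = F * sd σ G + sd σ F * G := by
  refine PowerSeries.ext fun n => ?_
  rw [coeff_sd, map_add, PowerSeries.coeff_mul, PowerSeries.coeff_mul, PowerSeries.coeff_mul,
    pd_sum σ _ fun p _ => mul_mem (hF p.1) (hG p.2), ← Finset.sum_add_distrib]
  refine Finset.sum_congr rfl fun p _ => ?_
  rw [pd_mul σ (hF p.1) (hG p.2), coeff_sd, coeff_sd]

theorem sd_comm (σ τ : PhaseIdx N) {F : PhaseSeries N} (hF : SmoothSeries F) :
    sd σ (sd τ F) = sd τ (sd σ F) := by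
  refine PowerSeries.ext fun n => ?_
  rw [coeff_sd, coeff_sd, coeff_sd, coeff_sd, pd_comm σ τ (hF n)]

theorem map_sd_one (σ : PhaseIdx N) : (1 : SeriesMatrix N).map (sd σ) = 0 := by
  refine seriesMatrix_ext fun n => ?_
  ext μ ν : 1
  have h := congrFun (congrFun (matCoeff_one (N := N) n) μ) ν
  rw [matCoeff_apply] at h
  rw [matCoeff_apply, Matrix.map_apply, coeff_sd, h]
  split_ifs
  · rw [Matrix.one_apply]
    split_ifs
    · rw [pd_one]
      rfl
    · rw [pd_zero]
      rfl
  · exact pd_zero σ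

theorem map_sd_mul (σ : PhaseIdx N) {A B : SeriesMatrix N} (hA : ∀ μ ν, SmoothSeries (A μ ν))
    (hB : ∀ μ ν, SmoothSeries (B μ ν)) :
    (A * B).map (sd σ) = A * B.map (sd σ) + A.map (sd σ) * B := by
  ext μ ν : 1
  rw [Matrix.map_apply, Matrix.add_apply, Matrix.mul_apply, Matrix.mul_apply, Matrix.mul_apply,
    sd_sum σ _ fun i _ => (hA μ i).mul (hB i ν), ← Finset.sum_add_distrib]
  exact Finset.sum_congr rfl fun i _ => sd_mul σ (hA μ i) (hB i ν)

theorem curl_apply (J : PhaseIdx N → PhaseSeries N) (μ ν : PhaseIdx N) :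
    curl J μ ν = sd μ (J ν) - sd ν (J μ) := rfl

theorem matCoeff_curl (J : PhaseIdx N → PhaseSeries N) (n : ℕ) (μ ν : PhaseIdx N) :
    matCoeff n (curl J) μ ν =
      pd μ (PowerSeries.coeff n (J ν)) - pd ν (PowerSeries.coeff n (J μ)) := by
  rw [matCoeff_apply, curl_apply, map_sub, coeff_sd, coeff_sd]

theorem curl_transpose (J : PhaseIdx N → PhaseSeries N) : (curl J).transpose = -curl J := by
  ext μ ν : 1
  rw [Matrix.transpose_apply, Matrix.neg_apply, curl_apply, curl_apply, neg_sub]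

theorem smoothSeries_curl {J : PhaseIdx N → PhaseSeries N} (hJ : ∀ μ, SmoothSeries (J μ))
    (μ ν : PhaseIdx N) : SmoothSeries (curl J μ ν) :=
  ((hJ ν).sd μ).sub ((hJ μ).sd ν)

theorem curl_closed {J : PhaseIdx N → PhaseSeries N} (hJ : ∀ μ, SmoothSeries (J μ))
    (a b c : PhaseIdx N) :
    sd a (curl J b c) + sd c (curl J a b) + sd b (curl J c a) = 0 := by
  simp only [curl_apply]
  rw [sd_sub a ((hJ c).sd b) ((hJ b).sd c), sd_sub c ((hJ b).sd a) ((hJ a).sd b),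
    sd_sub b ((hJ a).sd c) ((hJ c).sd a), sd_comm a b (hJ c), sd_comm a c (hJ b),
    sd_comm b c (hJ a)]
  ring

end SeriesDerivatives

/-! ### From closed two-forms to the Jacobi identity. -/

section InverseOfClosedForm

variable {N : ℕ} {J : PhaseIdx N → PhaseSeries N} {Om : SeriesMatrix N}

theorem transpose_eq_neg_of_curl_mul_eq_one (h : curl J * Om = 1) : Om.transpose = -Om := by
  have h1 := congrArg Matrix.transpose h
  rw [Matrix.transpose_mul, curl_transpose, Matrix.transpose_one, mul_neg] at h1
  calc Om.transpose = Om.transpose * (curl J * Om) := by rw [h, mul_one]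
    _ = -(-(Om.transpose * curl J)) * Om := by rw [neg_neg, mul_assoc]
    _ = -Om := by rw [h1, neg_one_mul]

theorem antisymm_of_curl_mul_eq_one (h : curl J * Om = 1) (μ ν : PhaseIdx N) :
    Om μ ν = -Om ν μ :=
  congrFun (congrFun (transpose_eq_neg_of_curl_mul_eq_one h) ν) μ

/-- Differentiate Ω̄Ω = 1 and multiply by Ω from the left. -/
theorem map_sd_of_curl_mul_eq_one (hJ : ∀ μ, SmoothSeries (J μ))
    (hOm : ∀ μ ν, SmoothSeries (Om μ ν)) (h : curl J * Om = 1) (σ : PhaseIdx N) :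
    Om.map (sd σ) = -(Om * (curl J).map (sd σ) * Om) := by
  have h1 := map_sd_mul σ (smoothSeries_curl hJ) hOm
  rw [h, map_sd_one] at h1
  have h2 : Om * curl J = 1 := mul_eq_one_comm.1 h
  have h3 := congrArg (Om * ·) h1
  simp only [mul_zero, mul_add, ← mul_assoc, h2, one_mul] at h3
  exact eq_neg_of_add_eq_zero_left h3.symm

/-- The inverse of a closed two-form satisfies the Jacobi identity. -/
theorem satisfiesJacobi_of_curl_mul_eq_one (hJ : ∀ μ, SmoothSeries (J μ))
    (hOm : ∀ μ ν, SmoothSeries (Om μ ν)) (h : curl J * Om = 1) : SatisfiesJacobi Om := by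
  have hanti := antisymm_of_curl_mul_eq_one h
  -- The sign in ∂Ω = −Ω(∂Ω̄)Ω is absorbed by the antisymmetry of the last factor. The cyclic sum
  -- becomes dΩ̄ contracted with three copies of Ω.
  have key : ∀ μ ν α, ∑ σ, Om μ σ * sd σ (Om ν α) =
      ∑ a, ∑ b, ∑ c, Om μ a * Om ν b * Om α c * sd a (curl J b c) := by
    intro μ ν α
    refine Finset.sum_congr rfl fun a _ => ?_
    have h1 : sd a (Om ν α) = -(Om * (curl J).map (sd a) * Om) ν α :=
      congrFun (congrFun (map_sd_of_curl_mul_eq_one hJ hOm h a) ν) α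
    rw [h1, Matrix.mul_apply, Finset.sum_comm, ← Finset.sum_neg_distrib, Finset.mul_sum]
    refine Finset.sum_congr rfl fun c _ => ?_
    rw [Matrix.mul_apply, hanti c α, mul_neg, mul_neg, mul_neg, neg_neg, Finset.sum_mul, Finset.mul_sum]
    refine Finset.sum_congr rfl fun b _ => ?_
    rw [Matrix.map_apply]
    ring
  intro μ ν α
  rw [Finset.sum_add_distrib, Finset.sum_add_distrib, key μ ν α, key α μ ν, key ν α μ]
  have h2 : ∑ a, ∑ b, ∑ c, Om α a * Om μ b * Om ν c * sd a (curl J b c) =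
      ∑ a, ∑ b, ∑ c, Om μ a * Om ν b * Om α c * sd c (curl J a b) := by
    rw [Finset.sum_comm]
    refine Finset.sum_congr rfl fun a _ => ?_
    rw [Finset.sum_comm]
    refine Finset.sum_congr rfl fun b _ => Finset.sum_congr rfl fun c _ => ?_
    ring
  have h3 : ∑ a, ∑ b, ∑ c, Om ν a * Om α b * Om μ c * sd a (curl J b c) =
      ∑ a, ∑ b, ∑ c, Om μ a * Om ν b * Om α c * sd b (curl J c a) := by
    rw [Finset.sum_congr rfl fun a _ => Finset.sum_comm, Finset.sum_comm]
    refine Finset.sum_congr rfl fun a _ => Finset.sum_congr rfl fun b _ =>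
      Finset.sum_congr rfl fun c _ => ?_
    ring
  rw [h2, h3]
  simp only [← Finset.sum_add_distrib]
  refine Finset.sum_eq_zero fun a _ => Finset.sum_eq_zero fun b _ =>
    Finset.sum_eq_zero fun c _ => ?_
  rw [← mul_add, ← mul_add, curl_closed hJ, mul_zero]

variable {ω : Fin N → Fin N → (Fin N → ℝ) → ℝ}

theorem IsPotentialSolution.isFormalRealization (h : IsPotentialSolution ω J Om) :
    IsFormalRealization ω Om where
  smooth := h.smooth
  antisymm := antisymm_of_curl_mul_eq_one h.inverse
  leading := h.leading
  base := h.base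
  jacobi := satisfiesJacobi_of_curl_mul_eq_one h.smooth_potential h.smooth h.inverse

end InverseOfClosedForm

/-! ### The equations order by order and their integrability. -/

section OrderByOrder

variable {N : ℕ} {ω : Fin N → Fin N → (Fin N → ℝ) → ℝ}

theorem coeff_thetaOmega (i j : Fin N) (n : ℕ) :
    PowerSeries.coeff n (thetaOmega ω i j) =
      if n = 1 then (fun ξ : Phase N => ω i j fun l => ξ (Sum.inl l)) else 0 := by
  rcases n with _ | n
  · simp [thetaOmega]
  · rw [thetaOmega, PowerSeries.coeff_succ_X_mul, PowerSeries.coeff_C]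
    simp

theorem coeff_thetaOmega_mem (hω : IsPoissonBivector ω) (i j : Fin N) (n : ℕ) :
    PowerSeries.coeff n (thetaOmega ω i j) ∈ smoothSubring N := by
  rw [coeff_thetaOmega]
  split_ifs
  · exact comp_fst_mem (hω.smooth i j)
  · exact zero_mem _

theorem coeff_thetaOmega_antisymm (hω : IsPoissonBivector ω) (i j : Fin N) (n : ℕ) :
    PowerSeries.coeff n (thetaOmega ω i j) = -PowerSeries.coeff n (thetaOmega ω j i) := by
  rw [coeff_thetaOmega, coeff_thetaOmega]
  split_ifs
  · funext ξ
    exact hω.antisymm i j _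
  · rw [neg_zero]

theorem pd_inr_coeff_thetaOmega (hω : IsPoissonBivector ω) (i j k : Fin N) (n : ℕ) :
    pd (Sum.inr k) (PowerSeries.coeff n (thetaOmega ω i j)) = 0 := by
  rw [coeff_thetaOmega]
  split_ifs
  · funext ξ
    rw [pd_comp_fst (hω.smooth i j)]
    rfl
  · exact pd_zero _

theorem canonMatrix_inl_mul_sum (i : Fin N) (v : PhaseIdx N → PhaseFn N) :
    ∑ σ, canonMatrix N (Sum.inl i) σ * v σ = v (Sum.inr i) := by
  rw [Fintype.sum_sum_type]
  simp [canonMatrix, Matrix.one_apply]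

theorem canonMatrix_mul_mul_inl_inl (M : PhaseMatrix N) (i j : Fin N) :
    (canonMatrix N * M * canonMatrix N) (Sum.inl i) (Sum.inl j) =
      -M (Sum.inr i) (Sum.inr j) := by
  rw [mul_assoc, Matrix.mul_apply, canonMatrix_inl_mul_sum, Matrix.mul_apply,
    Fintype.sum_sum_type]
  simp [canonMatrix, Matrix.one_apply]

theorem matCoeff_zero_of_mul {B Om : SeriesMatrix N} (h0 : matCoeff 0 Om = canonMatrix N)
    (h : matCoeff 0 (B * Om) = matCoeff 0 1) : matCoeff 0 B = -canonMatrix N := by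
  rw [matCoeff_mul, matCoeff_one, if_pos rfl] at h
  rw [Finset.Nat.antidiagonal_zero, Finset.sum_singleton, h0] at h
  have h1 := congrArg (· * canonMatrix N) h
  simp only [mul_assoc, canonMatrix_mul_self, mul_neg, mul_one, one_mul] at h1
  rw [← h1, neg_neg]

/-- The geometric series needs leading term Ω⁰, while Ω̄ starts with −Ω⁰; so −Ω̄ is inverted and the
sign restored. -/
theorem exists_inverse_of_curl {J : PhaseIdx N → PhaseSeries N} (hJ : ∀ μ, SmoothSeries (J μ))
    (h0 : matCoeff 0 (curl J) = -canonMatrix N) :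
    ∃ Om : SeriesMatrix N, (∀ μ ν, SmoothSeries (Om μ ν)) ∧ matCoeff 0 Om = canonMatrix N ∧
      curl J * Om = 1 := by
  refine ⟨-chainInverse (-curl J), forall_smoothSeries_iff.2 fun n => ?_, ?_, ?_⟩
  · rw [matCoeff_neg]
    refine neg_mem (matCoeff_chainInverse_mem (fun m => ?_) n)
    rw [matCoeff_neg]
    exact neg_mem (forall_smoothSeries_iff.1 (smoothSeries_curl hJ) m)
  · rw [matCoeff_neg, matCoeff_chainInverse_zero, neg_neg]
  · rw [mul_neg, ← neg_mul, mul_chainInverse]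
    rw [matCoeff_neg, h0, neg_neg]

/-- A solution in the orders below `n` agrees there with the inverse of the closed form
obtained by dropping all higher orders of the potential. -/
theorem IsPotentialSolutionBelow.exists_truncation {n : ℕ} (hn : 1 ≤ n)
    {J : PhaseIdx N → PhaseSeries N} {Om : SeriesMatrix N}
    (h : IsPotentialSolutionBelow ω n J Om) :
    ∃ (J' : PhaseIdx N → PhaseSeries N) (Om' : SeriesMatrix N),
      (∀ μ, SmoothSeries (J' μ)) ∧ (∀ μ ν, SmoothSeries (Om' μ ν)) ∧ curl J' * Om' = 1 ∧
      (∀ m < n, matCoeff m Om' = matCoeff m Om) ∧ matCoeff n Om' = -chainSum Om n := by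
  let J' : PhaseIdx N → PhaseSeries N := fun μ =>
    PowerSeries.mk fun m => if m < n then PowerSeries.coeff m (J μ) else 0
  have hJ' : ∀ μ, SmoothSeries (J' μ) := by
    intro μ m
    rw [PowerSeries.coeff_mk]
    split_ifs
    · exact h.smooth_potential μ m
    · exact (smoothSubring N).zero_mem
  have hlow : ∀ m < n, matCoeff m (curl J') = matCoeff m (curl J) := by
    intro m hm
    ext μ ν : 1
    rw [matCoeff_curl, matCoeff_curl, PowerSeries.coeff_mk, PowerSeries.coeff_mk, if_pos hm,
      if_pos hm]
  have htop : matCoeff n (curl J') = 0 := by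
    ext μ ν : 1
    rw [matCoeff_curl, PowerSeries.coeff_mk, PowerSeries.coeff_mk, if_neg (lt_irrefl n),
      if_neg (lt_irrefl n), pd_zero, pd_zero, sub_zero]
    rfl
  obtain ⟨Om', hsm, h0, hinv⟩ := exists_inverse_of_curl hJ'
    ((hlow 0 hn).trans (matCoeff_zero_of_mul h.leading (h.inverse 0 hn)))
  have hagree : ∀ m < n, matCoeff m Om' = matCoeff m Om := by
    intro m
    induction m using Nat.strong_induction_on with
    | _ m ih =>
      intro hm
      rcases m.eq_zero_or_pos with rfl | hpos
      · rw [h0, h.leading]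
      · rw [(matCoeff_mul_eq_one_iff h0 hpos fun k _ => by rw [hinv]).1 (by rw [hinv]),
          (matCoeff_mul_eq_one_iff h.leading hpos fun k hk => h.inverse k (hk.trans hm)).1
            (h.inverse m hm), hlow m hm, chainSum_congr fun k hk => ih k hk (hk.trans hm)]
  refine ⟨J', Om', hJ', hsm, hinv, hagree, ?_⟩
  -- The truncated form has no term of order n, so the formula for Ω'^n leaves only −S^n.
  rw [(matCoeff_mul_eq_one_iff h0 hn fun k _ => by rw [hinv]).1 (by rw [hinv]), htop,
    chainSum_congr hagree, mul_zero, zero_mul, neg_zero, zero_sub]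

/-- The chain sum of a solution below order `n` is closed in the momenta, by the Jacobi identities
of its truncation and of the bivector. -/
theorem IsPotentialSolutionBelow.chainSum_closed (hω : IsPoissonBivector ω) {n : ℕ} (hn : 2 ≤ n)
    {J : PhaseIdx N → PhaseSeries N} {Om : SeriesMatrix N}
    (h : IsPotentialSolutionBelow ω n J Om) (i j k : Fin N) :
    pd (Sum.inr k) (chainSum Om n (Sum.inl i) (Sum.inl j))
      + pd (Sum.inr i) (chainSum Om n (Sum.inl j) (Sum.inl k))
      + pd (Sum.inr j) (chainSum Om n (Sum.inl k) (Sum.inl i)) = 0 := by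
  obtain ⟨J', Om', hJ', hsm, hinv, hlow, htop⟩ := h.exists_truncation (by omega)
  have hbase : ∀ m < n, ∀ i j, PowerSeries.coeff m (Om' (Sum.inl i) (Sum.inl j)) =
      PowerSeries.coeff m (thetaOmega ω i j) := fun m hm i j => by
    rw [← h.base m hm, ← matCoeff_apply, hlow m hm, matCoeff_apply]
  have hcoeff : ∀ i j k : Fin N,
      PowerSeries.coeff n (∑ σ, Om' (Sum.inl i) σ * sd σ (Om' (Sum.inl j) (Sum.inl k))) =
        -pd (Sum.inr i) (chainSum Om n (Sum.inl j) (Sum.inl k)) +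
        ∑ l, PowerSeries.coeff (n - 1) (thetaOmega ω i l) *
          pd (Sum.inl l) (PowerSeries.coeff 1 (thetaOmega ω j k)) := by
    intro i j k
    -- Below order n, Ω'_{jk} = θω^{jk} has its only coefficient in order 1. What remains is (0, n),
    -- where Ω⁰ meets −S^n, and (n − 1, 1); these pairs differ because n ≥ 2.
    have hterm : ∀ p ∈ Finset.HasAntidiagonal.antidiagonal n,
        p ≠ (0, n) ∧ p ≠ (n - 1, 1) →
        ∑ σ, PowerSeries.coeff p.1 (Om' (Sum.inl i) σ) *
          PowerSeries.coeff p.2 (sd σ (Om' (Sum.inl j) (Sum.inl k))) = 0 := by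
      rintro ⟨a, b⟩ hp ⟨h1, h2⟩
      have hab : a + b = n := Finset.HasAntidiagonal.mem_antidiagonal.1 hp
      have hb : b < n := by
        refine lt_of_le_of_ne (by omega) fun hb => h1 ?_
        rw [Prod.mk.injEq]
        omega
      have hb1 : b ≠ 1 := by
        rintro rfl
        refine h2 ?_
        rw [Prod.mk.injEq]
        omega
      refine Finset.sum_eq_zero fun σ _ => ?_
      rw [coeff_sd, hbase b hb, coeff_thetaOmega, if_neg hb1, pd_zero, mul_zero]
    simp only [map_sum, PowerSeries.coeff_mul]
    rw [Finset.sum_comm, Finset.sum_eq_add (0, n) (n - 1, 1) (by simp; omega) hterm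
      (fun hp => absurd (Finset.HasAntidiagonal.mem_antidiagonal.2 (by simp)) hp)
      (fun hp => absurd (Finset.HasAntidiagonal.mem_antidiagonal.2 (by simp; omega)) hp)]
    congr 1
    · have h0 : ∀ σ, PowerSeries.coeff 0 (Om' (Sum.inl i) σ) = canonMatrix N (Sum.inl i) σ :=
        fun σ => by rw [← h.leading, ← hlow 0 (by omega), matCoeff_apply]
      simp only [h0]
      rw [canonMatrix_inl_mul_sum i fun σ =>
        PowerSeries.coeff n (sd σ (Om' (Sum.inl j) (Sum.inl k))), coeff_sd, ← matCoeff_apply, htop,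
        Matrix.neg_apply, pd_neg]
    · rw [Fintype.sum_sum_type]
      simp only [coeff_sd, hbase 1 (by omega), pd_inr_coeff_thetaOmega hω, mul_zero,
        Finset.sum_const_zero, add_zero, hbase (n - 1) (by omega)]
  -- The coefficient of order n − 1 of θω vanishes unless n = 2, and then this is the Jacobi
  -- identity of ω.
  have hpoisson : ∑ l, PowerSeries.coeff (n - 1) (thetaOmega ω i l) *
        pd (Sum.inl l) (PowerSeries.coeff 1 (thetaOmega ω j k)) +
      ∑ l, PowerSeries.coeff (n - 1) (thetaOmega ω k l) *
        pd (Sum.inl l) (PowerSeries.coeff 1 (thetaOmega ω i j)) +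
      ∑ l, PowerSeries.coeff (n - 1) (thetaOmega ω j l) *
        pd (Sum.inl l) (PowerSeries.coeff 1 (thetaOmega ω k i)) = 0 := by
    simp only [coeff_thetaOmega, if_true]
    split_ifs
    · funext ξ
      have hj := hω.jacobi i j k fun l => ξ (Sum.inl l)
      simp only [Pi.add_apply, Finset.sum_apply, Pi.mul_apply, pd_comp_fst (hω.smooth _ _),
        Sum.elim_inl]
      rw [← Finset.sum_add_distrib, ← Finset.sum_add_distrib]
      exact hj
    · simp
  have hjac := congrArg (PowerSeries.coeff n) (satisfiesJacobi_of_curl_mul_eq_one hJ' hsm hinv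
    (Sum.inl i) (Sum.inl j) (Sum.inl k))
  rw [Finset.sum_add_distrib, Finset.sum_add_distrib, map_add, map_add, hcoeff, hcoeff, hcoeff,
    map_zero] at hjac
  linear_combination hpoisson - hjac

theorem momentumRHS_mem (hω : IsPoissonBivector ω) {Om : SeriesMatrix N} {n : ℕ}
    (h : ∀ m < n, matCoeff m Om ∈ smoothMatrix N) (i j : Fin N) :
    momentumRHS ω Om n i j ∈ smoothSubring N :=
  add_mem (coeff_thetaOmega_mem hω i j n) (chainSum_mem h _ _)

theorem momentumRHS_zero (Om : SeriesMatrix N) :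
    momentumRHS ω Om 0 = fun _ _ => (0 : PhaseFn N) := by
  funext i j
  rw [momentumRHS, chainSum_of_lt_two Om (by norm_num), coeff_thetaOmega, if_neg (by norm_num),
    zero_add]
  rfl

theorem momentumRHS_congr {A B : SeriesMatrix N} {n : ℕ}
    (h : ∀ m < n, matCoeff m A = matCoeff m B) : momentumRHS ω A n = momentumRHS ω B n := by
  funext i j
  rw [momentumRHS, momentumRHS, chainSum_congr h]

/-- S^n is minus the order n coefficient of the inverse of the truncated form, which is
antisymmetric. -/
theorem IsPotentialSolutionBelow.momentumRHS_antisymm (hω : IsPoissonBivector ω) {n : ℕ}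
    (hn : 1 ≤ n) {J : PhaseIdx N → PhaseSeries N} {Om : SeriesMatrix N}
    (h : IsPotentialSolutionBelow ω n J Om) (i j : Fin N) :
    momentumRHS ω Om n i j = -momentumRHS ω Om n j i := by
  obtain ⟨J', Om', -, -, hinv, -, htop⟩ := h.exists_truncation hn
  have h1 := congrArg (PowerSeries.coeff n)
    (antisymm_of_curl_mul_eq_one hinv (Sum.inl i) (Sum.inl j))
  rw [map_neg, ← matCoeff_apply, ← matCoeff_apply, htop, Matrix.neg_apply, Matrix.neg_apply] at h1
  rw [momentumRHS, momentumRHS, coeff_thetaOmega_antisymm hω i j]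
  linear_combination -h1

/-- The term θω does not depend on p. For n = 1 nothing else is present; for n ≥ 2 the closedness of
S^n applies. -/
theorem IsPotentialSolutionBelow.momentumRHS_closed (hω : IsPoissonBivector ω) {n : ℕ}
    (hn : 1 ≤ n) {J : PhaseIdx N → PhaseSeries N} {Om : SeriesMatrix N}
    (h : IsPotentialSolutionBelow ω n J Om) (i j k : Fin N) :
    pd (Sum.inr k) (momentumRHS ω Om n i j) + pd (Sum.inr i) (momentumRHS ω Om n j k)
      + pd (Sum.inr j) (momentumRHS ω Om n k i) = 0 := by
  have hpd : ∀ i j k : Fin N, pd (Sum.inr k) (momentumRHS ω Om n i j) =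
      pd (Sum.inr k) (chainSum Om n (Sum.inl i) (Sum.inl j)) := by
    intro i j k
    have hc := chainSum_mem (n := n) fun m _ => forall_smoothSeries_iff.1 h.smooth m
    unfold momentumRHS
    rw [pd_add _ (coeff_thetaOmega_mem hω i j n) (hc _ _),
      pd_inr_coeff_thetaOmega hω, zero_add]
  rw [hpd, hpd, hpd]
  rcases hn.lt_or_eq with hlt | rfl
  · exact h.chainSum_closed hω hlt i j k
  · rw [chainSum_of_lt_two Om (by norm_num)]
    have hz : ∀ a b k, pd (Sum.inr k) ((0 : PhaseMatrix N) a b) = 0 := fun a b k => pd_zero _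
    rw [hz, hz, hz, add_zero, add_zero]

/-- The equations of order `n` for a solution in the orders below `n`. -/
theorem IsPotentialSolutionBelow.succ_iff {n : ℕ} (hn : 1 ≤ n)
    {J : PhaseIdx N → PhaseSeries N} {Om : SeriesMatrix N}
    (h : IsPotentialSolutionBelow ω n J Om) :
    IsPotentialSolutionBelow ω (n + 1) J Om ↔
      (∀ i j, pd (Sum.inr i) (PowerSeries.coeff n (J (Sum.inr j)))
        - pd (Sum.inr j) (PowerSeries.coeff n (J (Sum.inr i))) = momentumRHS ω Om n i j) ∧
      matCoeff n Om =
        -(canonMatrix N * matCoeff n (curl J) * canonMatrix N) - chainSum Om n := by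
  have hiff := matCoeff_mul_eq_one_iff h.leading hn h.inverse
  have hentry : matCoeff n Om =
        -(canonMatrix N * matCoeff n (curl J) * canonMatrix N) - chainSum Om n → ∀ i j,
      PowerSeries.coeff n (Om (Sum.inl i) (Sum.inl j)) =
        (pd (Sum.inr i) (PowerSeries.coeff n (J (Sum.inr j)))
          - pd (Sum.inr j) (PowerSeries.coeff n (J (Sum.inr i))))
        - chainSum Om n (Sum.inl i) (Sum.inl j) := by
    intro hOm i j
    rw [← matCoeff_apply, hOm, Matrix.sub_apply, Matrix.neg_apply, canonMatrix_mul_mul_inl_inl,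
      neg_neg, matCoeff_curl]
  constructor
  · intro h'
    have hOm := hiff.1 (h'.inverse n (Nat.lt_succ_self n))
    refine ⟨fun i j => ?_, hOm⟩
    have h1 := h'.base n (Nat.lt_succ_self n) i j
    rw [hentry hOm] at h1
    rw [momentumRHS, ← h1, sub_add_cancel]
  · rintro ⟨hG, hOm⟩
    refine ⟨h.smooth_potential, h.smooth, h.leading, fun m hm i j => ?_, fun m hm => ?_⟩
    · rcases (Nat.lt_succ_iff.1 hm).lt_or_eq with hlt | rfl
      · exact h.base m hlt i j
      · rw [hentry hOm, hG, momentumRHS, add_sub_cancel_right]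
    · rcases (Nat.lt_succ_iff.1 hm).lt_or_eq with hlt | rfl
      · exact h.inverse m hlt
      · exact hiff.2 hOm

theorem IsPotentialSolution.below {J : PhaseIdx N → PhaseSeries N} {Om : SeriesMatrix N}
    (h : IsPotentialSolution ω J Om) (n : ℕ) : IsPotentialSolutionBelow ω n J Om :=
  ⟨h.smooth_potential, h.smooth, h.leading, fun m _ i j => by rw [h.base],
    fun m _ => by rw [h.inverse]⟩

theorem isPotentialSolution_of_forall_below {J : PhaseIdx N → PhaseSeries N}
    {Om : SeriesMatrix N} (h : ∀ n, 1 ≤ n → IsPotentialSolutionBelow ω n J Om) :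
    IsPotentialSolution ω J Om :=
  ⟨(h 1 le_rfl).smooth_potential, (h 1 le_rfl).smooth, (h 1 le_rfl).leading,
    fun i j => PowerSeries.ext fun m =>
      (h (m + 1) (Nat.succ_le_succ m.zero_le)).base m m.lt_succ_self i j,
    seriesMatrix_ext fun m => (h (m + 1) (Nat.succ_le_succ m.zero_le)).inverse m m.lt_succ_self⟩

end OrderByOrder

/-! ### Fixed points of causal recursions. -/

section Recursion

theorem exists_forall_eq_of_strong_recursion {α : Type*} [Inhabited α]
    (F : ℕ → (ℕ → α) → α) (hF : ∀ n V W, (∀ m < n, V m = W m) → F n V = F n W) :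
    ∃ W : ℕ → α, ∀ n, W n = F n W := by
  -- The default value fills the entries from n on, which `F n` ignores by `hF`.
  let step : ∀ n : ℕ, (∀ m, m < n → α) → α :=
    fun n ih => F n fun m => if h : m < n then ih m h else default
  refine ⟨WellFounded.fix (C := fun _ => α) Nat.lt_wfRel.wf step, fun n => ?_⟩
  rw [WellFounded.fix_eq]
  refine hF n _ _ fun m hm => ?_
  exact dif_pos hm

end Recursion

/-! ### Construction of the solutions, uniqueness and completeness. -/

section Construction

variable {N : ℕ} {ω : Fin N → Fin N → (Fin N → ℝ) → ℝ}

/-- The potential built from the data `(I, f)` and the coefficients of `Ω`. -/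
def builtPotential (ω : Fin N → Fin N → (Fin N → ℝ) → ℝ) (I : Fin N → PhaseSeries N)
    (f : PhaseSeries N) (Om : SeriesMatrix N) : PhaseIdx N → PhaseSeries N :=
  Sum.elim I fun i => PowerSeries.mk fun n =>
    radialSolution (momentumRHS ω Om n) i + pd (Sum.inr i) (PowerSeries.coeff n f)

theorem builtFrom_iff {I : Fin N → PhaseSeries N} {f : PhaseSeries N}
    {J : PhaseIdx N → PhaseSeries N} {Om : SeriesMatrix N} :
    BuiltFrom ω I f J Om ↔ J = builtPotential ω I f Om := by
  constructor
  · rintro ⟨h1, h2⟩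
    funext μ
    rcases μ with i | i
    · exact h1 i
    · refine PowerSeries.ext fun n => ?_
      rw [h2, builtPotential, Sum.elim_inr, PowerSeries.coeff_mk]
  · rintro rfl
    exact ⟨fun i => rfl, fun n i => by rw [builtPotential, Sum.elim_inr, PowerSeries.coeff_mk]⟩

theorem coeff_builtPotential_inr (I : Fin N → PhaseSeries N) (f : PhaseSeries N)
    (Om : SeriesMatrix N) (n : ℕ) (i : Fin N) :
    PowerSeries.coeff n (builtPotential ω I f Om (Sum.inr i)) =
      radialSolution (momentumRHS ω Om n) i + pd (Sum.inr i) (PowerSeries.coeff n f) :=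
  (builtFrom_iff.2 rfl : BuiltFrom ω I f (builtPotential ω I f Om) Om).2 n i

theorem coeff_builtPotential_mem (hω : IsPoissonBivector ω) {I : Fin N → PhaseSeries N}
    {f : PhaseSeries N} (hI : IsConstructionData I f) {Om : SeriesMatrix N} {n : ℕ}
    (h : ∀ m < n, matCoeff m Om ∈ smoothMatrix N) (μ : PhaseIdx N) :
    PowerSeries.coeff n (builtPotential ω I f Om μ) ∈ smoothSubring N := by
  rcases μ with i | i
  · exact hI.smooth_vec i n
  · rw [coeff_builtPotential_inr]
    exact add_mem (radialSolution_mem (momentumRHS_mem hω h) i) (pd_mem _ (hI.smooth_fun n))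

theorem matCoeff_curl_builtPotential_congr (I : Fin N → PhaseSeries N) (f : PhaseSeries N)
    {A B : SeriesMatrix N} {n : ℕ} (h : ∀ m < n, matCoeff m A = matCoeff m B) :
    matCoeff n (curl (builtPotential ω I f A)) = matCoeff n (curl (builtPotential ω I f B)) := by
  have hc : ∀ μ, PowerSeries.coeff n (builtPotential ω I f A μ) =
      PowerSeries.coeff n (builtPotential ω I f B μ) := by
    rintro (i | i)
    · rfl
    · rw [coeff_builtPotential_inr, coeff_builtPotential_inr, momentumRHS_congr h]
  ext μ ν : 1
  rw [matCoeff_curl, matCoeff_curl, hc, hc]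

theorem matCoeff_zero_curl_builtPotential {I : Fin N → PhaseSeries N}
    {f : PhaseSeries N} (hI : IsConstructionData I f) (Om : SeriesMatrix N) :
    matCoeff 0 (curl (builtPotential ω I f Om)) = -canonMatrix N := by
  have hr : ∀ i, PowerSeries.coeff 0 (builtPotential ω I f Om (Sum.inr i)) =
      pd (Sum.inr i) (PowerSeries.coeff 0 f) := fun i => by
    rw [coeff_builtPotential_inr, momentumRHS_zero, radialSolution_zero, zero_add]
  have hl : ∀ i, PowerSeries.coeff 0 (builtPotential ω I f Om (Sum.inl i)) = _ := hI.leading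
  have hf := hI.smooth_fun 0
  have hpl : ∀ (σ : PhaseIdx N) (i : Fin N), pd σ ((fun ξ : Phase N => ξ (Sum.inr i)) +
      pd (Sum.inl i) (PowerSeries.coeff 0 f)) =
      (if σ = Sum.inr i then 1 else 0) + pd (Sum.inl i) (pd σ (PowerSeries.coeff 0 f)) :=
    fun σ i => by rw [pd_add _ (coord_mem _) (pd_mem _ hf), pd_coord, pd_comm _ _ hf]
  ext μ ν : 1
  rw [matCoeff_curl, Matrix.neg_apply]
  rcases μ with i | i <;> rcases ν with j | j
  · rw [hl, hl, hpl, hpl, if_neg (by simp), if_neg (by simp), pd_comm (Sum.inl i) _ hf]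
    simp [canonMatrix]
  · rw [hl, hr, hpl, canonMatrix, Matrix.fromBlocks_apply₁₂, Matrix.one_apply]
    by_cases h : i = j
    · subst h
      simp
    · simp [h, Ne.symm h]
  · rw [hl, hr, hpl, canonMatrix, Matrix.fromBlocks_apply₂₁, Matrix.neg_apply, Matrix.one_apply]
    by_cases h : i = j
    · subst h
      simp
    · simp [h]
  · rw [hr, hr, pd_comm _ _ hf]
    simp [canonMatrix]

/-- The coefficient `Ω^n` that the construction assigns to the coefficients of lower order. -/
def constructionStep (ω : Fin N → Fin N → (Fin N → ℝ) → ℝ) (I : Fin N → PhaseSeries N)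
    (f : PhaseSeries N) (Om : SeriesMatrix N) (n : ℕ) : PhaseMatrix N :=
  if n = 0 then canonMatrix N else
    -(canonMatrix N * matCoeff n (curl (builtPotential ω I f Om)) * canonMatrix N)
      - chainSum Om n

theorem constructionStep_congr (I : Fin N → PhaseSeries N) (f : PhaseSeries N)
    {A B : SeriesMatrix N} {n : ℕ} (h : ∀ m < n, matCoeff m A = matCoeff m B) :
    constructionStep ω I f A n = constructionStep ω I f B n := by
  rw [constructionStep, constructionStep, matCoeff_curl_builtPotential_congr I f h,
    chainSum_congr h]

theorem exists_forall_eq_constructionStep (I : Fin N → PhaseSeries N) (f : PhaseSeries N) :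
    ∃ Om : SeriesMatrix N, ∀ n, matCoeff n Om = constructionStep ω I f Om n := by
  obtain ⟨W, hW⟩ := exists_forall_eq_of_strong_recursion
    (fun n W => constructionStep ω I f (matSeries W) n) fun n V W h =>
      constructionStep_congr I f fun m hm => by
        rw [matCoeff_matSeries, matCoeff_matSeries, h m hm]
  exact ⟨matSeries W, fun n => by rw [matCoeff_matSeries, hW n]⟩

theorem eq_of_forall_eq_constructionStep {I : Fin N → PhaseSeries N} {f : PhaseSeries N}
    {A B : SeriesMatrix N} (hA : ∀ n, matCoeff n A = constructionStep ω I f A n)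
    (hB : ∀ n, matCoeff n B = constructionStep ω I f B n) : A = B := by
  refine seriesMatrix_ext fun n => ?_
  induction n using Nat.strong_induction_on with
  | _ n ih => rw [hA, hB, constructionStep_congr I f ih]

theorem smooth_of_forall_eq_constructionStep (hω : IsPoissonBivector ω)
    {I : Fin N → PhaseSeries N} {f : PhaseSeries N} (hI : IsConstructionData I f)
    {Om : SeriesMatrix N} (hOm : ∀ n, matCoeff n Om = constructionStep ω I f Om n) (n : ℕ) :
    matCoeff n Om ∈ smoothMatrix N := by
  induction n using Nat.strong_induction_on with
  | _ n ih =>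
    rw [hOm, constructionStep]
    split_ifs
    · exact canonMatrix_mem
    · refine sub_mem (neg_mem (mul_mem (mul_mem canonMatrix_mem fun μ ν => ?_) canonMatrix_mem))
        (chainSum_mem ih)
      rw [matCoeff_curl]
      exact sub_mem (pd_mem _ (coeff_builtPotential_mem hω hI ih ν))
        (pd_mem _ (coeff_builtPotential_mem hω hI ih μ))

/-- Induction on the order: a solution below n makes G^n antisymmetric and closed, so the radial
term solves the curl equation, while the gradient of f^n has no curl. -/
theorem isPotentialSolution_of_forall_eq_constructionStep (hω : IsPoissonBivector ω)
    {I : Fin N → PhaseSeries N} {f : PhaseSeries N} (hI : IsConstructionData I f)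
    {Om : SeriesMatrix N} (hOm : ∀ n, matCoeff n Om = constructionStep ω I f Om n) :
    IsPotentialSolution ω (builtPotential ω I f Om) Om := by
  have hsm := smooth_of_forall_eq_constructionStep hω hI hOm
  have h0 : matCoeff 0 Om = canonMatrix N := by rw [hOm, constructionStep, if_pos rfl]
  refine isPotentialSolution_of_forall_below fun n hn => ?_
  induction n, hn using Nat.le_induction with
  | base =>
    refine ⟨fun μ n => coeff_builtPotential_mem hω hI (fun m _ => hsm m) μ,
      forall_smoothSeries_iff.2 hsm, h0, fun m hm i j => ?_, fun m hm => ?_⟩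
    · obtain rfl : m = 0 := by omega
      rw [← matCoeff_apply, h0, coeff_thetaOmega, if_neg (by norm_num)]
      rfl
    · obtain rfl : m = 0 := by omega
      rw [matCoeff_mul, matCoeff_one, Finset.Nat.antidiagonal_zero, Finset.sum_singleton, h0,
        matCoeff_zero_curl_builtPotential hI, neg_mul, canonMatrix_mul_self, neg_neg, if_pos rfl]
  | succ n hn ih =>
    refine (ih.succ_iff hn).2 ⟨fun i j => ?_, ?_⟩
    · have hG := momentumRHS_mem hω (n := n) fun m _ => hsm m
      rw [coeff_builtPotential_inr, coeff_builtPotential_inr,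
        pd_add _ (radialSolution_mem hG j) (pd_mem _ (hI.smooth_fun n)),
        pd_add _ (radialSolution_mem hG i) (pd_mem _ (hI.smooth_fun n)),
        pd_comm (Sum.inr i) (Sum.inr j) (hI.smooth_fun n), add_sub_add_right_eq_sub,
        curl_radialSolution hG (ih.momentumRHS_antisymm hω hn) (ih.momentumRHS_closed hω hn)]
    · conv_lhs => rw [hOm, constructionStep, if_neg (by omega)]

/-- The equation of order n determines Ω^n, so uniqueness reduces to that of the fixed point. -/
theorem IsPotentialSolution.eq_constructionStep {I : Fin N → PhaseSeries N} {f : PhaseSeries N}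
    {Om : SeriesMatrix N} (h : IsPotentialSolution ω (builtPotential ω I f Om) Om) (n : ℕ) :
    matCoeff n Om = constructionStep ω I f Om n := by
  rw [constructionStep]
  split_ifs with hn
  · rw [hn, h.leading]
  · exact (((h.below n).succ_iff (by omega)).1 (h.below (n + 1))).2

theorem existsUnique_solution (hω : IsPoissonBivector ω)
    {I : Fin N → PhaseSeries N} {f : PhaseSeries N} (hI : IsConstructionData I f) :
    ∃! S : (PhaseIdx N → PhaseSeries N) × SeriesMatrix N,
      IsPotentialSolution ω S.1 S.2 ∧ BuiltFrom ω I f S.1 S.2 := by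
  obtain ⟨Om, hOm⟩ := exists_forall_eq_constructionStep (ω := ω) I f
  refine ⟨(builtPotential ω I f Om, Om),
    ⟨isPotentialSolution_of_forall_eq_constructionStep hω hI hOm, builtFrom_iff.2 rfl⟩, ?_⟩
  rintro ⟨J', Om'⟩ ⟨hS, hB⟩
  obtain rfl : J' = builtPotential ω I f Om' := builtFrom_iff.1 hB
  obtain rfl : Om' = Om := eq_of_forall_eq_constructionStep hS.eq_constructionStep hOm
  rfl

theorem IsPotentialSolution.exists_leading_function {J : PhaseIdx N → PhaseSeries N}
    {Om : SeriesMatrix N} (h : IsPotentialSolution ω J Om) :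
    ∃ g ∈ smoothSubring N,
      (∀ i, PowerSeries.coeff 0 (J (Sum.inl i)) =
        (fun ξ : Phase N => ξ (Sum.inr i)) + pd (Sum.inl i) g) ∧
      ∀ i, PowerSeries.coeff 0 (J (Sum.inr i)) = pd (Sum.inr i) g := by
  have h0 : matCoeff 0 (curl J) = -canonMatrix N :=
    matCoeff_zero_of_mul h.leading (by rw [h.inverse])
  -- (p, 0) is a potential of −Ω⁰, the leading term of Ω̄; J⁰ − (p, 0) is therefore closed in all
  -- coordinates.
  let v : PhaseIdx N → PhaseFn N := Sum.elim (fun i ξ => ξ (Sum.inr i)) fun _ => 0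
  have hv : ∀ μ, v μ ∈ smoothSubring N := by
    rintro (i | i)
    · exact coord_mem _
    · exact zero_mem _
  have hcurl : ∀ μ ν, pd μ (v ν) - pd ν (v μ) = -canonMatrix N μ ν := by
    rintro (i | i) (j | j)
    · simp [v, canonMatrix, pd_coord]
    · simp only [v, Sum.elim_inl, Sum.elim_inr, pd_coord, pd_zero, canonMatrix,
        Matrix.fromBlocks_apply₁₂, Matrix.one_apply]
      by_cases hij : i = j
      · subst hij
        simp
      · simp [hij, Ne.symm hij]
    · simp only [v, Sum.elim_inl, Sum.elim_inr, pd_coord, pd_zero, canonMatrix,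
        Matrix.fromBlocks_apply₂₁, Matrix.neg_apply, Matrix.one_apply]
      by_cases hij : i = j
      · subst hij
        simp
      · simp [hij]
    · simp [v, canonMatrix, pd_zero]
  obtain ⟨g, hg, hpd⟩ := exists_pd_eq_of_closed (fun _ => True)
    (u := fun μ => PowerSeries.coeff 0 (J μ) - v μ)
    (fun μ => sub_mem (S := Subring (PhaseFn N)) (h.smooth_potential μ 0) (hv μ))
    (fun μ ν _ _ => by
      have h1 := congrFun (congrFun h0 μ) ν
      rw [matCoeff_curl, Matrix.neg_apply, ← hcurl] at h1
      rw [pd_sub _ (h.smooth_potential ν 0) (hv ν), pd_sub _ (h.smooth_potential μ 0) (hv μ)]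
      linear_combination h1)
  refine ⟨g, hg, fun i => ?_, fun i => ?_⟩
  · rw [hpd _ trivial]
    exact (add_sub_cancel _ _).symm
  · rw [hpd _ trivial]
    exact (sub_zero _).symm

theorem IsPotentialSolution.exists_momentum_function (hω : IsPoissonBivector ω)
    {J : PhaseIdx N → PhaseSeries N} {Om : SeriesMatrix N} (h : IsPotentialSolution ω J Om)
    {n : ℕ} (hn : 1 ≤ n) :
    ∃ g ∈ smoothSubring N, ∀ i, PowerSeries.coeff n (J (Sum.inr i)) =
      radialSolution (momentumRHS ω Om n) i + pd (Sum.inr i) g := by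
  have hG := momentumRHS_mem hω (n := n) fun m _ => forall_smoothSeries_iff.1 h.smooth m
  have hb := h.below n
  -- The x-components of r are irrelevant, since the Poincaré lemma is applied in the momenta alone.
  let r : PhaseIdx N → PhaseFn N := Sum.elim (fun _ => 0) (radialSolution (momentumRHS ω Om n))
  have hr : ∀ μ, r μ ∈ smoothSubring N := by
    rintro (i | i)
    · exact zero_mem _
    · exact radialSolution_mem hG i
  obtain ⟨g, hg, hpd⟩ := exists_pd_eq_of_closed (fun μ : PhaseIdx N => μ.isRight)
    (u := fun μ => PowerSeries.coeff n (J μ) - r μ)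
    (fun μ => sub_mem (S := Subring (PhaseFn N)) (h.smooth_potential μ n) (hr μ)) (by
      rintro (i | i) (j | j) hi hj
      · simp at hi
      · simp at hi
      · simp at hj
      · rw [pd_sub _ (h.smooth_potential _ n) (hr _), pd_sub _ (h.smooth_potential _ n) (hr _)]
        have h1 := ((hb.succ_iff hn).1 (h.below (n + 1))).1 i j
        have h2 := curl_radialSolution hG (hb.momentumRHS_antisymm hω hn)
          (hb.momentumRHS_closed hω hn) i j
        simp only [r, Sum.elim_inr]
        linear_combination h1 - h2)
  refine ⟨g, hg, fun i => ?_⟩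
  rw [hpd _ rfl]
  exact (add_sub_cancel _ _).symm

theorem IsPotentialSolution.exists_builtFrom (hω : IsPoissonBivector ω)
    {J : PhaseIdx N → PhaseSeries N} {Om : SeriesMatrix N} (h : IsPotentialSolution ω J Om) :
    ∃ (I : Fin N → PhaseSeries N) (f : PhaseSeries N),
      IsConstructionData I f ∧ BuiltFrom ω I f J Om := by
  obtain ⟨g₀, hg₀, hlead, hmom⟩ := h.exists_leading_function
  -- In order zero f⁰ must be g₀, because the condition on J_i⁰ involves the same function.
  have hall : ∀ n, ∃ g ∈ smoothSubring N, (n = 0 → g = g₀) ∧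
      ∀ i, PowerSeries.coeff n (J (Sum.inr i)) =
        radialSolution (momentumRHS ω Om n) i + pd (Sum.inr i) g := by
    intro n
    rcases n.eq_zero_or_pos with rfl | hn
    · refine ⟨g₀, hg₀, fun _ => rfl, fun i => ?_⟩
      rw [hmom, momentumRHS_zero, radialSolution_zero, zero_add]
    · obtain ⟨g, hg, hpd⟩ := h.exists_momentum_function hω hn
      exact ⟨g, hg, fun h0 => absurd h0 (by omega), hpd⟩
  choose g hg hzero hpd using hall
  refine ⟨fun i => J (Sum.inl i), PowerSeries.mk g,
    ⟨fun i => h.smooth_potential _, fun n => ?_, fun i => ?_⟩, fun i => rfl, fun n i => ?_⟩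
  · rw [PowerSeries.coeff_mk]
    exact hg n
  · rw [PowerSeries.coeff_mk, hzero 0 rfl, hlead]
  · rw [PowerSeries.coeff_mk, hpd]

theorem exists_constructionData (N : ℕ) :
    ∃ (I : Fin N → PhaseSeries N) (f : PhaseSeries N), IsConstructionData I f := by
  refine ⟨fun i => PowerSeries.C fun ξ : Phase N => ξ (Sum.inr i), 0, fun i n => ?_, fun n => ?_,
    fun i => ?_⟩
  · rw [PowerSeries.coeff_C]
    split_ifs
    · exact coord_mem (Sum.inr i)
    · exact (smoothSubring N).zero_mem
  · rw [map_zero]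
    exact (smoothSubring N).zero_mem
  · rw [map_zero, pd_zero, add_zero, PowerSeries.coeff_C, if_pos rfl]

end Construction

end

/-! ### The main theorem. -/

theorem mainTheorem1 (N : ℕ) (ω : Fin N → Fin N → (Fin N → ℝ) → ℝ)
    (hω : IsPoissonBivector ω) :
    -- a formal symplectic realization obtained from a symplectic potential exists
    (∃ (Om : Matrix (PhaseIdx N) (PhaseIdx N) (PhaseSeries N)) (J : PhaseIdx N → PhaseSeries N),
      IsFormalRealization ω Om ∧ IsPotentialSolution ω J Om) ∧
    -- every solution of the equation for the potential is a formal symplectic realization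
    (∀ (J : PhaseIdx N → PhaseSeries N) (Om : Matrix (PhaseIdx N) (PhaseIdx N) (PhaseSeries N)),
      IsPotentialSolution ω J Om → IsFormalRealization ω Om) ∧
    -- order by order: the equations of order `n`, the equation for `J_{N+i}^n` among them,
    -- and its integrability condition
    (∀ n : ℕ, 1 ≤ n → ∀ (J : PhaseIdx N → PhaseSeries N)
      (Om : Matrix (PhaseIdx N) (PhaseIdx N) (PhaseSeries N)),
      IsPotentialSolutionBelow ω n J Om →
      (IsPotentialSolutionBelow ω (n + 1) J Om ↔
        (∀ i j, pd (Sum.inr i) (PowerSeries.coeff n (J (Sum.inr j)))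
            - pd (Sum.inr j) (PowerSeries.coeff n (J (Sum.inr i))) = momentumRHS ω Om n i j) ∧
        matCoeff n Om =
          -(canonMatrix N * matCoeff n (curl J) * canonMatrix N) - chainSum Om n) ∧
      ∀ i j k, pd (Sum.inr k) (momentumRHS ω Om n i j) + pd (Sum.inr i) (momentumRHS ω Om n j k)
        + pd (Sum.inr j) (momentumRHS ω Om n k i) = 0) ∧
    -- the freedom: each vector `J_i` and function `f` give exactly one solution,
    (∀ (I : Fin N → PhaseSeries N) (f : PhaseSeries N), IsConstructionData I f →
      ∃! S : (PhaseIdx N → PhaseSeries N) × Matrix (PhaseIdx N) (PhaseIdx N) (PhaseSeries N),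
        IsPotentialSolution ω S.1 S.2 ∧ BuiltFrom ω I f S.1 S.2) ∧
    -- and every solution is obtained in this way
    (∀ (J : PhaseIdx N → PhaseSeries N) (Om : Matrix (PhaseIdx N) (PhaseIdx N) (PhaseSeries N)),
      IsPotentialSolution ω J Om →
      ∃ (I : Fin N → PhaseSeries N) (f : PhaseSeries N),
        IsConstructionData I f ∧ BuiltFrom ω I f J Om) := by
  refine ⟨?_, fun J Om h => h.isFormalRealization, fun n hn J Om h =>
    ⟨h.succ_iff hn, h.momentumRHS_closed hω hn⟩, fun I f hI => existsUnique_solution hω hI,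
    fun J Om h => h.exists_builtFrom hω⟩
  -- Existence is the construction applied to the simplest data, J_i = p_i and f = 0.
  obtain ⟨I, f, hI⟩ := exists_constructionData N
  obtain ⟨⟨J, Om⟩, ⟨h, -⟩, -⟩ := existsUnique_solution hω hI
  exact ⟨Om, J, h.isFormalRealization, h⟩
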